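/- Let $X$ be a strictly convex reflexive real Banach space whose dual $X^*$ is strictly convex, let $A:X\supset D(A)\to 2^{X^*}$ be maximal monotone, where $D(A)=\{x: Ax\neq\emptyset\}$, and let $\varphi:[0,\infty)\to[0,\infty)$ be a gauge function: strictly increasing and continuous, with $\varphi(0)=0$ and $\varphi(r)\to\infty$ as $r\to\infty$. Let $$J_\varphi x=\{x^*\in X^*: \langle x^*,x\rangle=\varphi(\|x\|)\|x\|,\ \|x^*\|=\varphi(\|x\|)\}$$ be the corresponding duality mapping. For every $\lambda>0$ and $x\in X$ the inclusion $0\in J_\varphi(x_\lambda-x)+\lambda Ax_\lambda$ has exactly one solution $x_\lambda\in D(A)$. Put $J_\lambda^\varphi x:=x_\lambda$ and $A_\lambda^\varphi x:=\frac1\lambda J_\varphi(x-J_\lambda^\varphi x)$. Here $\to$ denotes norm convergence, $\rightharpoonup$ weak convergence, and demicontinuous means continuous from the norm topology to the weak topology. The following statements hold. (i) For every $\lambda>0$ the operator $A_\lambda^\varphi:X\to X^*$ is single-valued, monotone, bounded on bounded subsets of $X$, and demicontinuous. (ii) For every $x\in D(A)$ and $\lambda>0$, $\|A_\lambda^\varphi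 x\|\le |Ax|:=\inf\{\|x^*\|:x^*\in Ax\}$. (iii) For every $\lambda>0$ the operator $J_\lambda^\varphi:X\to D(A)$ is bounded on bounded subsets of $X$ and demicontinuous, and $\lim_{\lambda\to0^+}J_\lambda^\varphi x=x$ for all $x\in\overline{\operatorname{co}D(A)}$. (iv) If $\lambda_n>0$, $\lambda_n\to0$, $x_n\rightharpoonup x$ in $X$, $A_{\lambda_n}^\varphi x_n\rightharpoonup y$ in $X^*$ and $$\limsup_{n,m\to\infty}\langle A_{\lambda_n}^\varphi x_n-A_{\lambda_m}^\varphi x_m,\,x_n-x_m\rangle\le0,$$ then $y\in Ax$ and $$\lim_{n,m\to\infty}\langle A_{\lambda_n}^\varphi x_n-A_{\lambda_m}^\varphi x_m,\,x_n-x_m\rangle=0.$$ (v) For every $x\in D(A)$ the set $Ax$ has exactly one element $A^{\{0\}}x$ with $\|A^{\{0\}}x\|=|Ax|$, and for every sequence $\lambda_n>0$ with $\lambda_n\to0$ we have $A_{\lambda_n}^\varphi x\rightharpoonup A^{\{0\}}x$. If in addition $X^*$ is uniformly convex, then $A_{\lambda_n}^\varphi x\to A^{\{0\}}x$. (vi)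 If $\lambda_n>0$, $\lambda_n\to0$ and $x\notin\overline{D(A)}$, then $\lim_{n\to\infty}\|A_{\lambda_n}^\varphi x\|=\infty$. -/

import Mathlib

open Filter Topology NNReal

namespace GaugeYosida

/-- Reflexivity: the canonical embedding of `X` into its bidual is onto. -/
def IsReflexive (X : Type*) [NormedAddCommGroup X] [NormedSpace ℝ X] : Prop :=
  Function.Surjective (NormedSpace.inclusionInDoubleDual ℝ X)

/-- Gauge functions `φ : [0, ∞) → [0, ∞)`. -/
structure IsGauge (φ : ℝ≥0 → ℝ≥0) : Prop where
  strictMono : StrictMono φ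
  continuous : Continuous φ
  map_zero : φ 0 = 0
  tendsto_atTop : Tendsto φ atTop atTop

/-- Weak convergence in a real normed space. -/
def WeakTendsto {ι E : Type*} [NormedAddCommGroup E] [NormedSpace ℝ E]
    (u : ι → E) (l : Filter ι) (a : E) : Prop :=
  Tendsto (fun i => toWeakSpace ℝ E (u i)) l (𝓝 (toWeakSpace ℝ E a))

/-- Demicontinuity of an everywhere defined map: norm-to-weak continuity. -/
def Demicontinuous {X E : Type*} [NormedAddCommGroup X]
    [NormedAddCommGroup E] [NormedSpace ℝ E] (f : X → E) : Prop :=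
  Continuous fun x => toWeakSpace ℝ E (f x)

/-- The image of every bounded set is bounded. -/
def BoundedOnBounded {X E : Type*} [NormedAddCommGroup X] [NormedAddCommGroup E]
    (f : X → E) : Prop :=
  ∀ B : Set X, Bornology.IsBounded B → Bornology.IsBounded (f '' B)

section

variable {X : Type*} [NormedAddCommGroup X] [NormedSpace ℝ X]

/-- The effective domain of a multivalued operator. -/
def dom (A : X → Set (StrongDual ℝ X)) : Set X := {x | (A x).Nonempty}

/-- The graph of a multivalued operator. -/
def graph (A : X → Set (StrongDual ℝ X)) : Set (X × StrongDual ℝ X) := {p | p.2 ∈ A p.1}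

/-- Monotonicity of a multivalued operator. -/
def IsMonotone (A : X → Set (StrongDual ℝ X)) : Prop :=
  ∀ p ∈ graph A, ∀ q ∈ graph A, 0 ≤ (p.2 - q.2) (p.1 - q.1)

/-- Maximal monotonicity: the graph is maximal for inclusion among monotone graphs. -/
def IsMaximalMonotone (A : X → Set (StrongDual ℝ X)) : Prop :=
  IsMonotone A ∧
    ∀ B : X → Set (StrongDual ℝ X), IsMonotone B → graph A ⊆ graph B → graph B = graph A

/-- The (a priori multivalued) duality mapping with gauge `φ`. -/
def dualityMap (φ : ℝ≥0 → ℝ≥0) (x : X) : Set (StrongDual ℝ X) :=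
  {f | f x = φ ‖x‖₊ * ‖x‖ ∧ ‖f‖ = φ ‖x‖₊}

/-- All solutions `z` of the inclusion `0 ∈ J_φ (z - x) + lam A z`. -/
def solutionSet (A : X → Set (StrongDual ℝ X)) (φ : ℝ≥0 → ℝ≥0) (lam : ℝ) (x : X) : Set X :=
  {z | ∃ j ∈ dualityMap φ (z - x), ∃ a ∈ A z, 0 = j + lam • a}

/-- All values `lam⁻¹ j` with `j ∈ J_φ (x - z)` and `z` a solution of the inclusion. -/
def yosidaSet (A : X → Set (StrongDual ℝ X)) (φ : ℝ≥0 → ℝ≥0) (lam : ℝ) (x : X) :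
    Set (StrongDual ℝ X) :=
  {w | ∃ z ∈ solutionSet A φ lam x, ∃ j ∈ dualityMap φ (x - z), w = lam⁻¹ • j}

/-- The resolvent as a map: an element of `solutionSet`. It is determined by the set
as soon as the latter is a singleton. -/
noncomputable def gaugeResolvent (A : X → Set (StrongDual ℝ X)) (φ : ℝ≥0 → ℝ≥0) (lam : ℝ) (x : X) :
    X :=
  Classical.epsilon fun z => z ∈ solutionSet A φ lam x

/-- The Yosida approximant as a map: an element of `yosidaSet`. It is determined by the set
as soon as the latter is a singleton. -/
noncomputable def yosida (A : X → Set (StrongDual ℝ X)) (φ : ℝ≥0 → ℝ≥0) (lam : ℝ) (x : X) :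
    StrongDual ℝ X :=
  Classical.epsilon fun w => w ∈ yosidaSet A φ lam x

/-- `|Ax|`, the infimum of the norms of the elements of `A x` (used only for `x ∈ dom A`). -/
noncomputable def minNorm (A : X → Set (StrongDual ℝ X)) (x : X) : ℝ :=
  sInf ((fun f => ‖f‖) '' A x)

/-- `y` is an element of `A x` of minimal norm. -/
def IsMinimalSection (A : X → Set (StrongDual ℝ X)) (x : X) (y : StrongDual ℝ X) : Prop :=
  y ∈ A x ∧ ‖y‖ = minNorm A x

end

end GaugeYosida

/-!
The inclusion `0 ∈ J_φ (z - x) + lam A z` is solvable because `0` lies in the range of `J_φ + B`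
for every maximal monotone `B` on a reflexive space
(`IsMaximalMonotone.exists_neg_mem_dualityMap`). This is a Fenchel duality argument. With
`Φ = ∫ φ` and its conjugate `Ψ`, the Fitzpatrick function `F` of `B` satisfies
`F (x, f) ≥ f x ≥ -(Φ ‖x‖ + Ψ ‖f‖)`, so a closed hyperplane in `(X × X*) × ℝ` separates its epigraph
from the hypograph of the continuous concave function on the right. By reflexivity the normal of
the hyperplane is given by a pair `(z, a)`; Minty's criterion puts `(z, a)` into the graph of `B`,
and equality in Young's inequality says `-a ∈ J_φ z`. Strict convexity of `X` and of `X*` makes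
`J_φ` strictly monotone and single-valued, which yields uniqueness.

Everything else is read off from a pair `z = J_lam x`, `w = A_lam x`, characterised by `w ∈ A z`
and `lam w ∈ J_φ (x - z)` (`IsYosidaPair`). Testing monotonicity of `A` against a point `(u, a)` of
the graph gives `‖w‖ ‖x - z‖ ≤ ⟨w, x - u⟩ + ‖a‖ (‖x - z‖ + ‖x - u‖)`, from which the bounds and the
convergence of the resolvents follow. Limits are taken along ultrafilters, on which bounded families
converge weakly by Banach-Alaoglu and reflexivity; the limits are identified by
`IsMaximalMonotone.mem_of_tendsto`: a weak limit of graph points `(R, Y)` lies in the graph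
as soon as the limit of `⟨Y, R⟩` is at most the pairing of the limits.
-/

namespace GaugeYosida

/-! ### Gauge functions and Young's inequality -/

theorem IsGauge.surjective {φ : ℝ≥0 → ℝ≥0} (hφ : IsGauge φ) : Function.Surjective φ := by
  intro s
  refine mem_range_of_exists_le_of_exists_ge hφ.continuous ⟨0, ?_⟩ ?_
  · simp [hφ.map_zero]
  · exact ((hφ.tendsto_atTop.eventually (eventually_ge_atTop s))).exists

/-- A gauge as an order isomorphism of the half-line; its inverse is the gauge of the inverse
duality mapping. -/
noncomputable def IsGauge.orderIso {φ : ℝ≥0 → ℝ≥0} (hφ : IsGauge φ) : ℝ≥0 ≃o ℝ≥0 :=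
  hφ.strictMono.orderIsoOfSurjective φ hφ.surjective

/-- The primitive `t ↦ ∫₀ᵗ φ` of a gauge, which vanishes on the negative half-line. -/
noncomputable def primitive (φ : ℝ≥0 → ℝ≥0) (t : ℝ) : ℝ :=
  ∫ s in (0 : ℝ)..t, (φ s.toNNReal : ℝ)

/-- The Legendre conjugate `s ↦ s r - ∫₀ʳ φ`, `r = φ⁻¹ s`, of the primitive of a gauge. It has this
meaning for `0 ≤ s` only. -/
noncomputable def IsGauge.conjugate {φ : ℝ≥0 → ℝ≥0} (hφ : IsGauge φ) (s : ℝ) : ℝ :=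
  s * hφ.orderIso.symm s.toNNReal - primitive φ (hφ.orderIso.symm s.toNNReal)

section
variable {φ : ℝ≥0 → ℝ≥0} (hφ : IsGauge φ)
include hφ

theorem IsGauge.continuous_extend : Continuous fun s : ℝ => (φ s.toNNReal : ℝ) :=
  NNReal.continuous_coe.comp (hφ.continuous.comp continuous_real_toNNReal)

theorem IsGauge.hasDerivAt_primitive (t : ℝ) :
    HasDerivAt (primitive φ) (φ t.toNNReal) t :=
  (hφ.continuous_extend.integral_hasStrictDerivAt 0 t).hasDerivAt

theorem IsGauge.differentiable_primitive : Differentiable ℝ (primitive φ) :=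
  fun t => (hφ.hasDerivAt_primitive t).differentiableAt

/-- The subgradient inequality for the primitive, strict because the gauge is. -/
theorem IsGauge.primitive_add_lt {t r : ℝ≥0} (h : t ≠ r) :
    primitive φ r + φ r * (t - r) < primitive φ t := by
  rcases lt_or_gt_of_ne h with h | h
  · obtain ⟨c, hc, hd⟩ := exists_deriv_eq_slope (primitive φ) (NNReal.coe_lt_coe.2 h)
      hφ.differentiable_primitive.continuous.continuousOn
      hφ.differentiable_primitive.differentiableOn
    rw [(hφ.hasDerivAt_primitive c).deriv] at hd
    have h1 : (0 : ℝ) < r - t := sub_pos.2 (NNReal.coe_lt_coe.2 h)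
    have h2 : (φ c.toNNReal : ℝ) < φ r := by
      refine NNReal.coe_lt_coe.2 (hφ.strictMono ?_)
      rw [Real.toNNReal_lt_iff_lt_coe (t.2.trans hc.1.le)]
      exact hc.2
    rw [eq_div_iff h1.ne'] at hd
    nlinarith
  · obtain ⟨c, hc, hd⟩ := exists_deriv_eq_slope (primitive φ) (NNReal.coe_lt_coe.2 h)
      hφ.differentiable_primitive.continuous.continuousOn
      hφ.differentiable_primitive.differentiableOn
    rw [(hφ.hasDerivAt_primitive c).deriv] at hd
    have h1 : (0 : ℝ) < t - r := sub_pos.2 (NNReal.coe_lt_coe.2 h)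
    have h2 : (φ r : ℝ) < φ c.toNNReal := by
      refine NNReal.coe_lt_coe.2 (hφ.strictMono ?_)
      rw [Real.lt_toNNReal_iff_coe_lt]
      exact hc.1
    rw [eq_div_iff h1.ne'] at hd
    nlinarith

theorem IsGauge.monotone_primitive_deriv : Monotone (deriv (primitive φ)) := by
  intro a b hab
  rw [(hφ.hasDerivAt_primitive a).deriv, (hφ.hasDerivAt_primitive b).deriv]
  exact NNReal.coe_le_coe.2 (hφ.strictMono.monotone (Real.toNNReal_mono hab))

theorem IsGauge.convexOn_primitive : ConvexOn ℝ Set.univ (primitive φ) :=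
  hφ.monotone_primitive_deriv.convexOn_univ_of_deriv hφ.differentiable_primitive

theorem IsGauge.monotone_primitive : Monotone (primitive φ) :=
  monotone_of_deriv_nonneg hφ.differentiable_primitive fun t => by
    rw [(hφ.hasDerivAt_primitive t).deriv]; positivity

theorem IsGauge.primitive_add_conjugate (t : ℝ≥0) :
    primitive φ t + hφ.conjugate (φ t) = φ t * t := by
  have : hφ.orderIso.symm (φ t) = t := hφ.orderIso.symm_apply_apply t
  simp only [conjugate, Real.toNNReal_coe, this]
  ring

theorem IsGauge.young_strict {s t : ℝ≥0} (h : φ t ≠ s) :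
    (s : ℝ) * t < primitive φ t + hφ.conjugate s := by
  obtain ⟨r, rfl⟩ := hφ.surjective s
  have h1 := hφ.primitive_add_lt (t := t) (r := r) (by rintro rfl; exact h rfl)
  have h2 := hφ.primitive_add_conjugate r
  linarith

theorem IsGauge.young (s t : ℝ≥0) : (s : ℝ) * t ≤ primitive φ t + hφ.conjugate s := by
  by_cases h : φ t = s
  · subst h; exact (hφ.primitive_add_conjugate t).ge
  · exact (hφ.young_strict h).le

theorem IsGauge.continuous_conjugate : Continuous hφ.conjugate := by
  have h : Continuous fun s : ℝ => (hφ.orderIso.symm s.toNNReal : ℝ) :=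
    NNReal.continuous_coe.comp (hφ.orderIso.symm.continuous.comp continuous_real_toNNReal)
  exact (continuous_id.mul h).sub (hφ.differentiable_primitive.continuous.comp h)

theorem IsGauge.monotoneOn_conjugate : MonotoneOn hφ.conjugate (Set.Ici 0) := by
  intro a ha b hb hab
  lift a to ℝ≥0 using ha
  lift b to ℝ≥0 using hb
  obtain ⟨r, rfl⟩ := hφ.surjective a
  have h1 := hφ.primitive_add_conjugate r
  have h2 := hφ.young b r
  nlinarith [mul_le_mul_of_nonneg_right hab r.2]

theorem IsGauge.convexOn_conjugate : ConvexOn ℝ (Set.Ici 0) hφ.conjugate := by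
  refine ⟨convex_Ici 0, fun a ha b hb p q hp hq hpq => ?_⟩
  have hc : 0 ≤ p • a + q • b := add_nonneg (mul_nonneg hp ha) (mul_nonneg hq hb)
  lift a to ℝ≥0 using ha
  lift b to ℝ≥0 using hb
  generalize hcd : p • (a : ℝ) + q • (b : ℝ) = c at hc
  lift c to ℝ≥0 using hc
  obtain ⟨r, rfl⟩ := hφ.surjective c
  have h1 := hφ.primitive_add_conjugate r
  have h2 := mul_le_mul_of_nonneg_left (hφ.young a r) hp
  have h3 := mul_le_mul_of_nonneg_left (hφ.young b r) hq
  simp only [smul_eq_mul] at *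
  obtain rfl : q = 1 - p := by linarith
  rw [← hcd] at h1 ⊢
  linarith

theorem IsGauge.convexOn_primitive_norm (E : Type*) [NormedAddCommGroup E] [NormedSpace ℝ E] :
    ConvexOn ℝ Set.univ fun x : E => primitive φ ‖x‖ :=
  (hφ.convexOn_primitive.subset (Set.subset_univ _)
    (by rw [Set.image_univ]; exact (isPreconnected_range continuous_norm).convex)).comp
    (convexOn_norm convex_univ) (hφ.monotone_primitive.monotoneOn _)

theorem IsGauge.convexOn_conjugate_norm (E : Type*) [NormedAddCommGroup E] [NormedSpace ℝ E] :
    ConvexOn ℝ Set.univ fun x : E => hφ.conjugate ‖x‖ := by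
  have hs : (norm '' (Set.univ : Set E)) ⊆ Set.Ici 0 := by
    rintro _ ⟨x, -, rfl⟩; exact norm_nonneg x
  exact (hφ.convexOn_conjugate.subset hs
    (by rw [Set.image_univ]; exact (isPreconnected_range continuous_norm).convex)).comp
    (convexOn_norm convex_univ) (hφ.monotoneOn_conjugate.mono hs)

end

/-! ### Maximal monotone operators -/

section
variable {X : Type*} [NormedAddCommGroup X] [NormedSpace ℝ X]

/-- Minty's criterion: maximality forces every pair monotonically related to the graph to belong
to it. -/
theorem IsMaximalMonotone.mem {A : X → Set (StrongDual ℝ X)} (hA : IsMaximalMonotone A)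
    {x : X} {y : StrongDual ℝ X} (h : ∀ z, ∀ a ∈ A z, 0 ≤ (y - a) (x - z)) : y ∈ A x := by
  have hg : graph (fun z => A z ∪ {b | z = x ∧ b = y}) = graph A := by
    refine hA.2 _ ?_ fun p hp => Or.inl hp
    rintro ⟨p, p'⟩ (hp | hp) ⟨q, q'⟩ (hq | hq)
    · exact hA.1 (p, p') hp (q, q') hq
    · obtain ⟨rfl, rfl⟩ := hq
      have := h p p' hp
      simp only [sub_apply, map_sub] at this ⊢
      linarith
    · obtain ⟨rfl, rfl⟩ := hp
      exact h q q' hq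
    · obtain ⟨rfl, rfl⟩ := hp
      obtain ⟨rfl, rfl⟩ := hq
      simp
  have : (x, y) ∈ graph (fun z => A z ∪ {b | z = x ∧ b = y}) := Or.inr ⟨rfl, rfl⟩
  rw [hg] at this
  exact this

theorem IsMaximalMonotone.of_forall_mem {A : X → Set (StrongDual ℝ X)} (hA : IsMonotone A)
    (h : ∀ x y, (∀ z, ∀ a ∈ A z, 0 ≤ (y - a) (x - z)) → y ∈ A x) : IsMaximalMonotone A := by
  refine ⟨hA, fun B hB hAB => hAB.antisymm' ?_⟩
  rintro ⟨x, y⟩ hxy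
  exact h x y fun z a ha => hB (x, y) hxy (z, a) (hAB ha)

theorem IsMonotone.apply_nonneg {A : X → Set (StrongDual ℝ X)} (hA : IsMonotone A) {x z : X}
    {a b : StrongDual ℝ X} (ha : a ∈ A x) (hb : b ∈ A z) : 0 ≤ (a - b) (x - z) :=
  hA (x, a) ha (z, b) hb

theorem IsMaximalMonotone.dom_nonempty {A : X → Set (StrongDual ℝ X)}
    (hA : IsMaximalMonotone A) : (dom A).Nonempty := by
  by_contra h
  have hA0 : ∀ z, ∀ a ∈ A z, 0 ≤ ((0 : StrongDual ℝ X) - a) (0 - z) :=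
    fun z a ha => (h ⟨z, a, ha⟩).elim
  exact h ⟨0, 0, hA.mem hA0⟩

theorem IsMaximalMonotone.comp_add_smul {A : X → Set (StrongDual ℝ X)} (hA : IsMaximalMonotone A)
    {lam : ℝ} (hlam : 0 < lam) (x : X) :
    IsMaximalMonotone fun z => {b | ∃ a ∈ A (z + x), b = lam • a} := by
  refine IsMaximalMonotone.of_forall_mem ?_ fun z b h => ?_
  · rintro ⟨p, _⟩ ⟨p', hp, rfl⟩ ⟨q, _⟩ ⟨q', hq, rfl⟩
    have := hA.1.apply_nonneg hp hq
    rw [add_sub_add_right_eq_sub] at this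
    simpa [← smul_sub, hlam] using mul_nonneg hlam.le this
  · refine ⟨lam⁻¹ • b, hA.mem fun w a ha => ?_, by rw [smul_inv_smul₀ hlam.ne']⟩
    have h1 := h (w - x) (lam • a) ⟨a, by simpa using ha, rfl⟩
    have h2 : (lam⁻¹ • b - a) (z + x - w) = lam⁻¹ * (b - lam • a) (z - (w - x)) := by
      rw [show z - (w - x) = z + x - w by abel]
      simp only [sub_apply, smul_apply, smul_eq_mul]
      field_simp
    rw [h2]; positivity

theorem IsMaximalMonotone.convex {A : X → Set (StrongDual ℝ X)} (hA : IsMaximalMonotone A)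
    (x : X) : Convex ℝ (A x) := by
  intro a ha b hb p q hp hq hpq
  refine hA.mem fun z c hc => ?_
  have h1 := mul_nonneg hp (hA.1.apply_nonneg ha hc)
  have h2 := mul_nonneg hq (hA.1.apply_nonneg hb hc)
  have h3 : p • a + q • b - c = p • (a - c) + q • (b - c) := by
    rw [smul_sub, smul_sub, sub_add_sub_comm, ← add_smul, hpq, one_smul]
  rw [h3]
  simpa using add_nonneg h1 h2

end

/-! ### Surjectivity: solvability of the resolvent inclusion -/

section
variable {X : Type*} [NormedAddCommGroup X] [NormedSpace ℝ X]

theorem exists_norm_le_apply_eq_mul (x : X) {r : ℝ} (hr : 0 ≤ r) :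
    ∃ f : StrongDual ℝ X, ‖f‖ ≤ r ∧ f x = r * ‖x‖ := by
  obtain ⟨g, hg, hgx⟩ := exists_dual_vector'' ℝ x
  refine ⟨r • g, ?_, by simp [hgx]⟩
  rw [norm_smul, Real.norm_of_nonneg hr]
  exact mul_le_of_le_one_right hr hg

/-- In a reflexive space bounded linear functionals attain their norm. -/
theorem IsReflexive.exists_norm_le_apply_eq_mul (hX : IsReflexive X) (f : StrongDual ℝ X) {r : ℝ}
    (hr : 0 ≤ r) : ∃ x : X, ‖x‖ ≤ r ∧ f x = r * ‖f‖ := by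
  obtain ⟨g, hg, hgf⟩ := GaugeYosida.exists_norm_le_apply_eq_mul f hr
  obtain ⟨x, rfl⟩ := hX g
  refine ⟨x, ?_, by simpa using hgf⟩
  rwa [← (NormedSpace.inclusionInDoubleDualLi ℝ (E := X)).norm_map x]

theorem convex_setOf_fitzpatrick_le (A : X → Set (StrongDual ℝ X)) :
    Convex ℝ {q : (X × StrongDual ℝ X) × ℝ |
      ∀ z, ∀ a ∈ A z, a q.1.1 + q.1.2 z - a z ≤ q.2} := by
  intro q hq q' hq' s t hs ht hst z a ha
  have h1 := mul_le_mul_of_nonneg_left (hq z a ha) hs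
  have h2 := mul_le_mul_of_nonneg_left (hq' z a ha) ht
  obtain rfl : t = 1 - s := by linarith
  simp only [Prod.fst_add, Prod.snd_add, Prod.smul_fst, Prod.smul_snd, map_add, map_smul,
    add_apply, smul_apply, smul_eq_mul]
  linarith

/-- The Fitzpatrick function of a maximal monotone operator lies above the duality pairing. -/
theorem IsMaximalMonotone.apply_le_of_fitzpatrick_le {A : X → Set (StrongDual ℝ X)}
    (hA : IsMaximalMonotone A) {x : X} {f : StrongDual ℝ X} {t : ℝ}
    (h : ∀ z, ∀ a ∈ A z, a x + f z - a z ≤ t) : f x ≤ t := by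
  by_contra! hlt
  have hf : f ∈ A x := hA.mem fun z a ha => by
    have := h z a ha
    simp only [sub_apply, map_sub]
    linarith
  have := h x f hf
  linarith

/-- Rockafellar's surjectivity theorem for the duality mapping: `0` lies in the range of
`J_φ + A`. -/
theorem IsMaximalMonotone.exists_neg_mem_dualityMap (hX : IsReflexive X) {φ : ℝ≥0 → ℝ≥0}
    (hφ : IsGauge φ) {A : X → Set (StrongDual ℝ X)} (hA : IsMaximalMonotone A) :
    ∃ z, ∃ a ∈ A z, -a ∈ dualityMap φ z := by
  set G : X × StrongDual ℝ X → ℝ := fun p => primitive φ ‖p.1‖ + hφ.conjugate ‖p.2‖ with hG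
  have young : ∀ (x : X) (f : StrongDual ℝ X), -f x ≤ G (x, f) := fun x f =>
    ((neg_le_abs _).trans (f.le_opNorm x)).trans (hφ.young ‖f‖₊ ‖x‖₊)
  have hGcont : Continuous G :=
    (hφ.differentiable_primitive.continuous.comp continuous_fst.norm).add
      (hφ.continuous_conjugate.comp continuous_snd.norm)
  have hGconv : ConvexOn ℝ Set.univ G :=
    ((hφ.convexOn_primitive_norm X).comp_linearMap (LinearMap.fst ℝ X (StrongDual ℝ X))).add
      ((hφ.convexOn_conjugate_norm (StrongDual ℝ X)).comp_linearMap
        (LinearMap.snd ℝ X (StrongDual ℝ X)))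
  -- Separate the strict hypograph of `-G` from the epigraph of the Fitzpatrick function.
  obtain ⟨L, u, hD, hE⟩ := geometric_hahn_banach_open
    (s := {q : (X × StrongDual ℝ X) × ℝ | G q.1 + q.2 < 0})
    (t := {q : (X × StrongDual ℝ X) × ℝ | ∀ z, ∀ a ∈ A z, a q.1.1 + q.1.2 z - a z ≤ q.2})
    (by
      intro p hp q hq s t hs ht hst
      have h1 := hGconv.2 (Set.mem_univ p.1) (Set.mem_univ q.1) hs ht hst
      simp only [Set.mem_ofPred_eq, smul_eq_mul] at hp hq h1
      change G (s • p.1 + t • q.1) + (s * p.2 + t * q.2) < 0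
      rcases hs.eq_or_lt with rfl | hs
      · obtain rfl : t = 1 := by linarith
        linarith
      · have h2 := mul_neg_of_pos_of_neg hs hp
        have h3 := mul_nonpos_of_nonneg_of_nonpos ht hq.le
        linarith)
    (isOpen_lt ((hGcont.comp continuous_fst).add continuous_snd) continuous_const)
    (convex_setOf_fitzpatrick_le A)
    (by
      rw [Set.disjoint_left]
      intro q hq hq'
      have h1 := hA.apply_le_of_fitzpatrick_le hq'
      have h2 := young q.1.1 q.1.2
      simp only [Set.mem_ofPred_eq] at hq
      change _ ≤ G q.1 at h2
      linarith)
  set c : ℝ := L (0, 1) with hc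
  set f : StrongDual ℝ X := (L.comp (ContinuousLinearMap.inl ℝ _ ℝ)).comp
    (ContinuousLinearMap.inl ℝ X (StrongDual ℝ X)) with hf
  obtain ⟨v, hv⟩ := hX ((L.comp (ContinuousLinearMap.inl ℝ _ ℝ)).comp
    (ContinuousLinearMap.inr ℝ X (StrongDual ℝ X)))
  have hL : ∀ (x : X) (g : StrongDual ℝ X) (t : ℝ), L ((x, g), t) = f x + g v + c * t := by
    intro x g t
    have h1 : g v = L ((0, g), 0) := by
      rw [← NormedSpace.dual_def ℝ X v g, hv]; rfl
    have h2 : f x = L ((x, 0), 0) := rfl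
    have h3 : c * t = L (0, t) := by
      rw [hc, mul_comm, ← smul_eq_mul, ← map_smul]; simp
    rw [h1, h2, h3, ← map_add, ← map_add]
    simp
  have hA' : ∀ z, ∀ a ∈ A z, u ≤ f z + a v + c * a z := by
    intro z a ha
    rw [← hL]
    refine hE _ fun w b hb => ?_
    have := hA.1.apply_nonneg ha hb
    simp only [sub_apply, map_sub] at this ⊢
    linarith
  -- The domain of `A` is nonempty and `G` is finite, so the separating hyperplane is not vertical.
  have hc0 : 0 < c := by
    obtain ⟨z, a, ha⟩ := hA.dom_nonempty
    have h1 := hA' z a ha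
    have h2 := hD ((z, a), -G (z, a) - 1) (by
      change G (z, a) + (-G (z, a) - 1) < 0
      linarith)
    rw [hL] at h2
    have h3 := young z a
    nlinarith
  have hle : ∀ x g, f x + g v - c * G (x, g) ≤ u := by
    intro x g
    refine le_of_forall_pos_lt_add fun ε hε => ?_
    have hεc : 0 < ε / c := div_pos hε hc0
    have h := hD ((x, g), -G (x, g) - ε / c) (by
      change G (x, g) + (-G (x, g) - ε / c) < 0
      linarith)
    rw [hL, mul_sub, mul_div_cancel₀ _ hc0.ne'] at h
    linarith
  obtain ⟨z, rfl⟩ : ∃ z, v = -(c • z) := ⟨-(c⁻¹ • v), by simp [hc0.ne']⟩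
  obtain ⟨a, ha⟩ : ∃ a, f = -(c • a) := ⟨-(c⁻¹ • f), by simp [hc0.ne']⟩
  rw [ha] at hle hA'
  simp only [neg_apply, smul_apply, smul_eq_mul, map_neg, map_smul] at hle hA'
  have hconj : c * G (z, a) ≤ u := by
    obtain ⟨r, hr⟩ := hφ.surjective ‖a‖₊
    obtain ⟨x, hx, hax⟩ := hX.exists_norm_le_apply_eq_mul (-a) r.2
    obtain ⟨g, hg, hgz⟩ := GaugeYosida.exists_norm_le_apply_eq_mul (-z) (φ ‖z‖₊).2
    have h1 : primitive φ ‖x‖ ≤ primitive φ r := hφ.monotone_primitive hx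
    have h2 : hφ.conjugate ‖g‖ ≤ hφ.conjugate (φ ‖z‖₊) :=
      hφ.monotoneOn_conjugate (norm_nonneg g) (φ ‖z‖₊).2 hg
    have h3 := hφ.primitive_add_conjugate r
    have h4 := hφ.primitive_add_conjugate ‖z‖₊
    have h5 := hle x g
    have h6 : primitive φ ‖z‖ + hφ.conjugate ‖a‖ ≤ -a x - g z -
        (primitive φ ‖x‖ + hφ.conjugate ‖g‖) := by
      rw [hr] at h3
      simp only [neg_apply, map_neg, norm_neg, NNReal.val_eq_coe, coe_nnnorm] at *
      linarith
    have h7 := mul_le_mul_of_nonneg_left h6 hc0.le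
    simp only [hG] at h5 ⊢
    linarith
  have hza : a ∈ A z := hA.mem fun w b hb => by
    have h1 := hA' w b hb
    have h2 := young z a
    simp only [sub_apply, map_sub]
    refine nonneg_of_mul_nonneg_right ?_ hc0
    nlinarith
  have heq : primitive φ ‖z‖₊ + hφ.conjugate ‖a‖₊ ≤ -a z := by
    have h1 := hA' z a hza
    refine le_of_mul_le_mul_left ?_ hc0
    change c * G (z, a) ≤ _
    linarith
  have hnorm : φ ‖z‖₊ = ‖a‖₊ := by
    by_contra hne
    have h1 := hφ.young_strict hne
    have h2 := (neg_le_abs _).trans (a.le_opNorm z)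
    simp only [coe_nnnorm] at h1 h2 heq
    linarith
  refine ⟨z, a, hza, ?_, by simp [hnorm]⟩
  have h1 := hφ.young ‖a‖₊ ‖z‖₊
  have h2 := (neg_le_abs _).trans (a.le_opNorm z)
  rw [hnorm]
  simp only [coe_nnnorm, neg_apply] at *
  linarith

theorem IsMaximalMonotone.solutionSet_nonempty (hX : IsReflexive X) {φ : ℝ≥0 → ℝ≥0}
    (hφ : IsGauge φ) {A : X → Set (StrongDual ℝ X)} (hA : IsMaximalMonotone A) {lam : ℝ}
    (hlam : 0 < lam) (x : X) : (solutionSet A φ lam x).Nonempty := by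
  obtain ⟨z, _, ⟨a, ha, rfl⟩, hj⟩ := (hA.comp_add_smul hlam x).exists_neg_mem_dualityMap hX hφ
  exact ⟨z + x, _, by simpa using hj, a, ha, by simp⟩

end

/-! ### The duality mapping and uniqueness of the resolvent -/

section
variable {X : Type*} [NormedAddCommGroup X] [NormedSpace ℝ X]

theorem neg_mem_dualityMap {φ : ℝ≥0 → ℝ≥0} {x : X} {j : StrongDual ℝ X}
    (h : j ∈ dualityMap φ x) : -j ∈ dualityMap φ (-x) :=
  ⟨by simpa using h.1, by simpa using h.2⟩

theorem eq_of_mem_dualityMap [StrictConvexSpace ℝ (StrongDual ℝ X)] {φ : ℝ≥0 → ℝ≥0}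
    (hφ : IsGauge φ) {x : X} {j k : StrongDual ℝ X} (hj : j ∈ dualityMap φ x)
    (hk : k ∈ dualityMap φ x) : j = k := by
  refine eq_of_norm_eq_of_norm_add_eq (hj.2.trans hk.2.symm) ((norm_add_le _ _).antisymm ?_)
  rcases eq_or_ne x 0 with rfl | hx
  · rw [hj.2, hk.2]
    simp [hφ.map_zero]
  · have h1 := (le_abs_self _).trans ((j + k).le_opNorm x)
    rw [add_apply, hj.1, hk.1, ← add_mul] at h1
    rw [hj.2, hk.2]
    exact le_of_mul_le_mul_right h1 (norm_pos_iff.2 hx)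

/-- Monotonicity of the duality mapping with an explicit lower bound, both terms of which are
nonnegative; they vanish only for equal norms and when `j` norms `y`. -/
theorem apply_sub_nonneg_of_mem_dualityMap {φ : ℝ≥0 → ℝ≥0} (hφ : IsGauge φ) {x y : X}
    {j k : StrongDual ℝ X} (hj : j ∈ dualityMap φ x) (hk : k ∈ dualityMap φ y) :
    ((φ ‖x‖₊ : ℝ) - φ ‖y‖₊) * (‖x‖ - ‖y‖) + (φ ‖x‖₊ * ‖y‖ - j y) ≤ (j - k) (x - y) ∧
      0 ≤ ((φ ‖x‖₊ : ℝ) - φ ‖y‖₊) * (‖x‖ - ‖y‖) ∧ 0 ≤ φ ‖x‖₊ * ‖y‖ - j y := by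
  have h1 := (le_abs_self _).trans (j.le_opNorm y)
  have h2 := (le_abs_self _).trans (k.le_opNorm x)
  rw [hj.2] at h1
  rw [hk.2] at h2
  refine ⟨?_, ?_, by linarith⟩
  · simp only [sub_apply, map_sub, hj.1, hk.1]
    linarith
  · rcases le_total ‖x‖₊ ‖y‖₊ with h | h
    · exact mul_nonneg_of_nonpos_of_nonpos
        (sub_nonpos.2 (NNReal.coe_le_coe.2 (hφ.strictMono.monotone h))) (sub_nonpos.2 h)
    · exact mul_nonneg (sub_nonneg.2 (NNReal.coe_le_coe.2 (hφ.strictMono.monotone h)))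
        (sub_nonneg.2 h)

/-- In a strictly convex space the duality mapping is strictly monotone. -/
theorem eq_of_dualityMap_apply_sub_nonpos [StrictConvexSpace ℝ X] {φ : ℝ≥0 → ℝ≥0}
    (hφ : IsGauge φ) {x y : X} {j k : StrongDual ℝ X} (hj : j ∈ dualityMap φ x)
    (hk : k ∈ dualityMap φ y) (h : (j - k) (x - y) ≤ 0) : x = y := by
  obtain ⟨h1, h2, h3⟩ := apply_sub_nonneg_of_mem_dualityMap hφ hj hk
  have h4 : ((φ ‖x‖₊ : ℝ) - φ ‖y‖₊) * (‖x‖ - ‖y‖) = 0 := by linarith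
  have hxy : ‖x‖ = ‖y‖ := by
    rcases mul_eq_zero.1 h4 with h | h
    · exact congrArg NNReal.toReal
        (hφ.strictMono.injective (NNReal.coe_injective (sub_eq_zero.1 h)))
    · exact sub_eq_zero.1 h
  refine eq_of_norm_eq_of_norm_add_eq hxy ((norm_add_le _ _).antisymm ?_)
  rcases eq_or_ne x 0 with rfl | hx
  · simp
  have hpos : 0 < (φ ‖x‖₊ : ℝ) := by
    have : φ 0 < φ ‖x‖₊ := hφ.strictMono (nnnorm_pos.2 hx)
    rw [hφ.map_zero] at this
    exact NNReal.coe_pos.2 this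
  have h5 := (le_abs_self _).trans (j.le_opNorm (x + y))
  rw [map_add, hj.1, hj.2] at h5
  refine le_of_mul_le_mul_left ?_ hpos
  linarith

/-- `(z, w)` is a resolvent-approximant pair of `A` at `x` with parameter `lam`: `w` lies in `A z`
and `lam w` in `J_φ (x - z)`. -/
structure IsYosidaPair (A : X → Set (StrongDual ℝ X)) (φ : ℝ≥0 → ℝ≥0) (lam : ℝ) (x z : X)
    (w : StrongDual ℝ X) : Prop where
  mem : w ∈ A z
  smul_mem : lam • w ∈ dualityMap φ (x - z)

variable {A : X → Set (StrongDual ℝ X)} {φ : ℝ≥0 → ℝ≥0} {lam : ℝ} {x z : X} {w : StrongDual ℝ X}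

theorem exists_isYosidaPair (hz : z ∈ solutionSet A φ lam x) :
    ∃ w, IsYosidaPair A φ lam x z w := by
  obtain ⟨j, hj, a, ha, h0⟩ := hz
  refine ⟨a, ha, ?_⟩
  have := neg_mem_dualityMap hj
  rwa [neg_sub, neg_eq_of_add_eq_zero_right h0.symm] at this

theorem IsYosidaPair.mem_solutionSet (h : IsYosidaPair A φ lam x z w) :
    z ∈ solutionSet A φ lam x :=
  ⟨-(lam • w), by simpa using neg_mem_dualityMap h.smul_mem, w, h.mem, by simp⟩

theorem IsYosidaPair.mem_yosidaSet (hlam : 0 < lam) (h : IsYosidaPair A φ lam x z w) :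
    w ∈ yosidaSet A φ lam x :=
  ⟨z, h.mem_solutionSet, _, h.smul_mem, by rw [inv_smul_smul₀ hlam.ne']⟩

theorem IsYosidaPair.resolvent_unique [StrictConvexSpace ℝ X] (hφ : IsGauge φ)
    (hA : IsMonotone A) (hlam : 0 < lam) (h : IsYosidaPair A φ lam x z w) {z' : X}
    {w' : StrongDual ℝ X} (h' : IsYosidaPair A φ lam x z' w') : z = z' := by
  refine sub_right_injective (b := x)
    (eq_of_dualityMap_apply_sub_nonpos hφ h.smul_mem h'.smul_mem ?_)
  have := mul_nonneg hlam.le (hA.apply_nonneg h.mem h'.mem)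
  simp only [sub_apply, map_sub, smul_apply, smul_eq_mul] at *
  linarith

theorem IsYosidaPair.approximant_unique [StrictConvexSpace ℝ (StrongDual ℝ X)] (hφ : IsGauge φ)
    (hlam : 0 < lam) (h : IsYosidaPair A φ lam x z w) {w' : StrongDual ℝ X}
    (h' : IsYosidaPair A φ lam x z w') : w = w' :=
  smul_right_injective _ hlam.ne' (eq_of_mem_dualityMap hφ h.smul_mem h'.smul_mem)

section
variable [StrictConvexSpace ℝ X] [StrictConvexSpace ℝ (StrongDual ℝ X)]

theorem isYosidaPair_of_mem (hφ : IsGauge φ) (hA : IsMonotone A) (hlam : 0 < lam)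
    (hz : z ∈ solutionSet A φ lam x) (hw : w ∈ yosidaSet A φ lam x) :
    IsYosidaPair A φ lam x z w := by
  obtain ⟨v, hv⟩ := exists_isYosidaPair hz
  obtain ⟨z', hz', j, hj, rfl⟩ := hw
  obtain ⟨v', hv'⟩ := exists_isYosidaPair hz'
  obtain rfl := hv.resolvent_unique hφ hA hlam hv'
  rwa [eq_of_mem_dualityMap hφ hj hv.smul_mem, inv_smul_smul₀ hlam.ne']

theorem isYosidaPair_yosida (hX : IsReflexive X) (hφ : IsGauge φ) (hA : IsMaximalMonotone A)
    (hlam : 0 < lam) (x : X) :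
    IsYosidaPair A φ lam x (gaugeResolvent A φ lam x) (yosida A φ lam x) := by
  have hs := hA.solutionSet_nonempty hX hφ hlam x
  obtain ⟨w, hw⟩ := exists_isYosidaPair hs.some_mem
  exact isYosidaPair_of_mem hφ hA.1 hlam (Classical.epsilon_spec hs)
    (Classical.epsilon_spec (p := fun w => w ∈ yosidaSet A φ lam x) ⟨w, hw.mem_yosidaSet hlam⟩)

theorem solutionSet_eq_singleton (hX : IsReflexive X) (hφ : IsGauge φ)
    (hA : IsMaximalMonotone A) (hlam : 0 < lam) (x : X) :
    solutionSet A φ lam x = {gaugeResolvent A φ lam x} := by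
  have h := isYosidaPair_yosida hX hφ hA hlam x
  refine Set.eq_singleton_iff_unique_mem.2 ⟨h.mem_solutionSet, fun z hz => ?_⟩
  obtain ⟨w, hw⟩ := exists_isYosidaPair hz
  exact hw.resolvent_unique hφ hA.1 hlam h

theorem yosidaSet_eq_singleton (hX : IsReflexive X) (hφ : IsGauge φ)
    (hA : IsMaximalMonotone A) (hlam : 0 < lam) (x : X) :
    yosidaSet A φ lam x = {yosida A φ lam x} := by
  have h := isYosidaPair_yosida hX hφ hA hlam x
  exact Set.eq_singleton_iff_unique_mem.2 ⟨h.mem_yosidaSet hlam, fun w hw =>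
    (isYosidaPair_of_mem hφ hA.1 hlam h.mem_solutionSet hw).approximant_unique hφ hlam h⟩

end

/-! ### Estimates for the resolvent and the approximant -/

theorem IsYosidaPair.mul_norm (hlam : 0 < lam) (h : IsYosidaPair A φ lam x z w) :
    lam * ‖w‖ = φ ‖x - z‖₊ := by
  rw [← h.smul_mem.2, norm_smul, Real.norm_of_nonneg hlam.le]

theorem IsYosidaPair.apply_sub (hlam : 0 < lam) (h : IsYosidaPair A φ lam x z w) :
    w (x - z) = ‖w‖ * ‖x - z‖ := by
  have h1 := h.smul_mem.1
  rw [← h.mul_norm hlam, smul_apply, smul_eq_mul, mul_assoc] at h1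
  exact mul_left_cancel₀ hlam.ne' h1

theorem IsYosidaPair.norm_mul_le (hlam : 0 < lam) (hA : IsMonotone A)
    (h : IsYosidaPair A φ lam x z w) {u : X} {a : StrongDual ℝ X} (ha : a ∈ A u) :
    ‖w‖ * ‖x - z‖ ≤ w (x - u) + ‖a‖ * (‖x - z‖ + ‖x - u‖) := by
  have h1 := hA.apply_nonneg h.mem ha
  have h2 : -a (z - u) ≤ ‖a‖ * (‖x - z‖ + ‖x - u‖) := by
    refine ((neg_le_abs _).trans (a.le_opNorm _)).trans ?_
    gcongr
    rw [← norm_neg (x - z)]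
    calc ‖z - u‖ = ‖-(x - z) + (x - u)‖ := by congr 1; abel
      _ ≤ _ := norm_add_le _ _
  rw [← h.apply_sub hlam]
  simp only [sub_apply, map_sub] at *
  linarith

/-- The approximant at a point of the domain is bounded by each value of the operator. -/
theorem IsYosidaPair.norm_le (hφ : IsGauge φ) (hlam : 0 < lam) (hA : IsMonotone A)
    (h : IsYosidaPair A φ lam x z w) {a : StrongDual ℝ X} (ha : a ∈ A x) : ‖w‖ ≤ ‖a‖ := by
  rcases eq_or_ne x z with rfl | hxz
  · have := h.mul_norm hlam
    rw [sub_self, nnnorm_zero, hφ.map_zero, NNReal.coe_zero] at this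
    rw [(mul_eq_zero.1 this).resolve_left hlam.ne']
    exact norm_nonneg a
  · have h1 := h.norm_mul_le hlam hA ha
    rw [sub_self, map_zero, norm_zero, zero_add, add_zero] at h1
    exact le_of_mul_le_mul_right h1 (norm_pos_iff.2 (sub_ne_zero.2 hxz))

theorem IsYosidaPair.norm_le_minNorm (hφ : IsGauge φ) (hlam : 0 < lam) (hA : IsMonotone A)
    (h : IsYosidaPair A φ lam x z w) (hx : x ∈ dom A) : ‖w‖ ≤ minNorm A x := by
  refine le_csInf (hx.image _) ?_
  rintro _ ⟨a, ha, rfl⟩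
  exact h.norm_le hφ hlam hA ha

/-- The displacement `x - z` is bounded, uniformly for bounded parameters and bounded `x`. -/
theorem exists_norm_sub_le (hφ : IsGauge φ) (hA : IsMaximalMonotone A) (D M : ℝ) :
    ∃ C : ℝ≥0, ∀ (lam : ℝ) (x z : X) (w : StrongDual ℝ X), 0 < lam → lam ≤ M → ‖x‖ ≤ D →
      IsYosidaPair A φ lam x z w → ‖x - z‖₊ ≤ C := by
  obtain ⟨u, a, ha⟩ := hA.dom_nonempty
  obtain ⟨s, hs⟩ := hφ.surjective (3 * M * ‖a‖).toNNReal
  refine ⟨max (2 * (D + ‖u‖)).toNNReal s, fun lam x z w hlam hM hx h => ?_⟩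
  rw [le_max_iff]
  by_contra! hlt
  have h1 := (Real.le_coe_toNNReal _).trans_lt (NNReal.coe_lt_coe.2 hlt.1)
  have h2 := hφ.strictMono hlt.2
  rw [hs] at h2
  replace h2 := (Real.le_coe_toNNReal _).trans_lt (NNReal.coe_lt_coe.2 h2)
  rw [← h.mul_norm hlam] at h2
  have h3 := h.norm_mul_le hlam hA.1 ha
  have h4 := (le_abs_self _).trans (w.le_opNorm (x - u))
  have h5 : ‖x - u‖ ≤ D + ‖u‖ := (norm_sub_le _ _).trans (by gcongr)
  simp only [coe_nnnorm] at h1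
  have h0 : 0 ≤ ‖x - u‖ := norm_nonneg _
  set r := ‖x - z‖
  set d := ‖x - u‖
  have h6 : ‖w‖ * (r / 2) ≤ ‖a‖ * (3 * r / 2) := by
    have h7 : ‖w‖ * (r / 2) ≤ ‖w‖ * (r - d) := by gcongr; linarith
    have h8 : ‖a‖ * (r + d) ≤ ‖a‖ * (3 * r / 2) := by gcongr; linarith
    linarith
  have h9 : ‖w‖ ≤ 3 * ‖a‖ := by
    refine le_of_mul_le_mul_right ?_ (show 0 < r / 2 by linarith)
    linarith
  have hM0 : 0 ≤ M := hlam.le.trans hM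
  have h10 : lam * ‖w‖ ≤ M * (3 * ‖a‖) := by gcongr
  linarith

end

/-! ### Weak convergence along ultrafilters -/

theorem _root_.IsCompact.exists_tendsto_ultrafilter {ι Y : Type*} [TopologicalSpace Y] {K : Set Y}
    (hK : IsCompact K) {U : Ultrafilter ι} {f : ι → Y} (h : ∀ᶠ i in U, f i ∈ K) :
    ∃ y ∈ K, Tendsto f U (𝓝 y) :=
  hK.ultrafilter_le_nhds (U.map f) (le_principal_iff.2 h)

theorem exists_tendsto_of_abs_le {ι : Type*} {U : Ultrafilter ι} {f : ι → ℝ} {C : ℝ}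
    (h : ∀ᶠ i in U, |f i| ≤ C) : ∃ α, Tendsto f U (𝓝 α) := by
  obtain ⟨α, -, hα⟩ := (isCompact_Icc (a := -C) (b := C)).exists_tendsto_ultrafilter
    (h.mono fun i hi => abs_le.1 hi)
  exact ⟨α, hα⟩

section
variable {X : Type*} [NormedAddCommGroup X] [NormedSpace ℝ X] {ι : Type*}

theorem weakTendsto_iff {u : ι → X} {l : Filter ι} {x : X} :
    WeakTendsto u l x ↔ ∀ f : StrongDual ℝ X, Tendsto (fun i => f (u i)) l (𝓝 (f x)) := by
  refine WeakBilin.tendsto_iff_forall_eval_tendsto _ fun a b hab => ?_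
  refine (NormedSpace.inclusionInDoubleDualLi ℝ (E := X)).injective ?_
  ext f
  exact DFunLike.congr_fun hab f

/-- On the dual of a reflexive space the weak and the weak-star convergence agree. -/
theorem IsReflexive.weakTendsto_dual_iff (hX : IsReflexive X) {u : ι → StrongDual ℝ X}
    {l : Filter ι} {y : StrongDual ℝ X} :
    WeakTendsto u l y ↔ ∀ x, Tendsto (fun i => u i x) l (𝓝 (y x)) := by
  rw [weakTendsto_iff]
  refine ⟨fun h x => h (NormedSpace.inclusionInDoubleDual ℝ X x), fun h f => ?_⟩
  obtain ⟨x, rfl⟩ := hX f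
  exact h x

theorem exists_tendsto_apply_of_norm_le {U : Ultrafilter ι} {u : ι → StrongDual ℝ X} {C : ℝ}
    (h : ∀ᶠ i in U, ‖u i‖ ≤ C) :
    ∃ y : StrongDual ℝ X, ∀ x, Tendsto (fun i => u i x) U (𝓝 (y x)) := by
  obtain ⟨y, -, hy⟩ := (WeakDual.isCompact_closedBall (0 : StrongDual ℝ X)
    C).exists_tendsto_ultrafilter (f := fun i => StrongDual.toWeakDual (u i))
    (h.mono fun i hi => by simpa using hi)
  exact ⟨WeakDual.toStrongDual y, fun x => ((WeakDual.eval_continuous x).tendsto y).comp hy⟩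

theorem IsReflexive.exists_tendsto_apply_of_norm_le (hX : IsReflexive X) {U : Ultrafilter ι}
    {u : ι → X} {C : ℝ} (h : ∀ᶠ i in U, ‖u i‖ ≤ C) :
    ∃ x : X, ∀ f : StrongDual ℝ X, Tendsto (fun i => f (u i)) U (𝓝 (f x)) := by
  obtain ⟨y, hy⟩ := GaugeYosida.exists_tendsto_apply_of_norm_le (X := StrongDual ℝ X) (U := U)
    (u := fun i => NormedSpace.inclusionInDoubleDual ℝ X (u i)) (C := C)
    (h.mono fun i hi => by
      rwa [← (NormedSpace.inclusionInDoubleDualLi ℝ (E := X)).norm_map (u i)] at hi)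
  obtain ⟨x, rfl⟩ := hX y
  exact ⟨x, hy⟩

/-- Strong convergence of the arguments and weak-star convergence of bounded functionals give
convergence of the pairing. -/
theorem tendsto_apply_of_tendsto {l : Filter ι} {Y : ι → StrongDual ℝ X} {R : ι → X}
    {y : StrongDual ℝ X} {x : X} {C : ℝ} (hC : ∀ᶠ i in l, ‖Y i‖ ≤ C)
    (hY : ∀ v, Tendsto (fun i => Y i v) l (𝓝 (y v))) (hR : Tendsto R l (𝓝 x)) :
    Tendsto (fun i => Y i (R i)) l (𝓝 (y x)) := by
  have h1 : Tendsto (fun i => Y i (R i - x)) l (𝓝 0) := by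
    have h2 : Tendsto (fun i => C * ‖R i - x‖) l (𝓝 0) := by
      simpa using (tendsto_iff_norm_sub_tendsto_zero.1 hR).const_mul C
    refine squeeze_zero_norm' (hC.mono fun i hi => ?_) h2
    exact (Y i).le_of_opNorm_le hi _
  simpa using h1.add (hY x)

theorem norm_le_of_tendsto_apply {l : Filter ι} [NeBot l] {Y : ι → StrongDual ℝ X}
    {y : StrongDual ℝ X} {c : ι → ℝ} {C : ℝ} (hC : ∀ᶠ i in l, ‖Y i‖ ≤ c i)
    (hc : Tendsto c l (𝓝 C)) (hY : ∀ v, Tendsto (fun i => Y i v) l (𝓝 (y v))) : ‖y‖ ≤ C := by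
  have hC0 : 0 ≤ C := ge_of_tendsto hc (hC.mono fun i hi => (norm_nonneg _).trans hi)
  refine y.opNorm_le_bound hC0 fun v => ?_
  exact le_of_tendsto_of_tendsto (hY v).norm (hc.mul_const ‖v‖)
    (hC.mono fun i hi => (Y i).le_of_opNorm_le hi v)

theorem norm_le_of_tendsto_apply' {l : Filter ι} [NeBot l] {u : ι → X} {x : X} {c : ι → ℝ} {C : ℝ}
    (hC : ∀ᶠ i in l, ‖u i‖ ≤ c i) (hc : Tendsto c l (𝓝 C))
    (hu : ∀ f : StrongDual ℝ X, Tendsto (fun i => f (u i)) l (𝓝 (f x))) : ‖x‖ ≤ C := by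
  have := norm_le_of_tendsto_apply (Y := fun i => NormedSpace.inclusionInDoubleDualLi ℝ (u i))
    (y := NormedSpace.inclusionInDoubleDualLi ℝ x) (c := c) (C := C) (l := l)
    (by simpa only [LinearIsometry.norm_map] using hC) hc hu
  simpa only [LinearIsometry.norm_map] using this

theorem exists_norm_le_of_tendsto_apply [CompleteSpace X] {Y : ℕ → StrongDual ℝ X}
    {y : StrongDual ℝ X} (hY : ∀ v, Tendsto (fun n => Y n v) atTop (𝓝 (y v))) :
    ∃ C, ∀ n, ‖Y n‖ ≤ C := by
  refine banach_steinhaus fun v => ?_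
  obtain ⟨C, hC⟩ := (Metric.isBounded_range_of_tendsto _ (hY v)).exists_norm_le
  exact ⟨C, fun n => hC _ ⟨n, rfl⟩⟩

theorem WeakTendsto.exists_norm_le {u : ℕ → X} {x : X} (hu : WeakTendsto u atTop x) :
    ∃ C, ∀ n, ‖u n‖ ≤ C := by
  obtain ⟨C, hC⟩ := exists_norm_le_of_tendsto_apply
    (Y := fun n => NormedSpace.inclusionInDoubleDualLi ℝ (u n))
    (y := NormedSpace.inclusionInDoubleDualLi ℝ x) (weakTendsto_iff.1 hu)
  exact ⟨C, by simpa only [LinearIsometry.norm_map] using hC⟩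

/-- The Radon-Riesz property of a uniformly convex dual, for weak-star convergence. -/
theorem tendsto_of_norm_le_of_uniformConvex [UniformConvexSpace (StrongDual ℝ X)] {l : Filter ι}
    {Y : ι → StrongDual ℝ X} {y : StrongDual ℝ X} (hC : ∀ᶠ i in l, ‖Y i‖ ≤ ‖y‖)
    (hY : ∀ v, Tendsto (fun i => Y i v) l (𝓝 (y v))) : Tendsto Y l (𝓝 y) := by
  rw [Metric.tendsto_nhds]
  intro ε hε
  obtain ⟨δ, hδ, h⟩ :=
    exists_forall_closed_ball_dist_add_le_two_mul_sub (StrongDual ℝ X) hε ‖y‖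
  -- A vector of the unit ball almost norming `y` almost norms `Y i + y` as well.
  obtain ⟨v, hv, hyv⟩ : ∃ v : X, ‖v‖ ≤ 1 ∧ ‖y‖ - δ / 2 < y v := by
    rcases lt_or_ge (‖y‖ - δ / 2) 0 with hneg | hpos
    · exact ⟨0, by simp, by simpa using hneg⟩
    · obtain ⟨v, hv, hyv⟩ := y.exists_lt_apply_of_lt_opNorm (r := ‖y‖ - δ / 2) (by linarith)
      rcases le_total 0 (y v) with h0 | h0
      · exact ⟨v, hv.le, by rwa [Real.norm_of_nonneg h0] at hyv⟩
      · exact ⟨-v, by simpa using hv.le, by rwa [Real.norm_of_nonpos h0, ← map_neg] at hyv⟩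
  filter_upwards [hC, (hY v).eventually (lt_mem_nhds hyv)] with i hi hiv
  rw [dist_eq_norm]
  by_contra! hge
  have h1 := h hi le_rfl hge
  have h2 := (le_abs_self _).trans ((Y i + y).le_opNorm_of_le hv)
  rw [add_apply, mul_one] at h2
  linarith

/-! ### Weak limits of graph points -/

variable {A : X → Set (StrongDual ℝ X)} {l : Filter ι} [NeBot l] {R : ι → X}
  {Y : ι → StrongDual ℝ X} {z : X} {y : StrongDual ℝ X} {α : ℝ}

theorem IsMonotone.nonneg_of_tendsto (hA : IsMonotone A) (hYR : ∀ i, Y i ∈ A (R i))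
    (hR : ∀ f : StrongDual ℝ X, Tendsto (fun i => f (R i)) l (𝓝 (f z)))
    (hY : ∀ v, Tendsto (fun i => Y i v) l (𝓝 (y v)))
    (hα : Tendsto (fun i => Y i (R i)) l (𝓝 α)) {u : X} {a : StrongDual ℝ X} (ha : a ∈ A u) :
    0 ≤ α - y u - a z + a u := by
  refine ge_of_tendsto' (((hα.sub (hY u)).sub (hR a)).add_const (a u)) fun i => ?_
  have := hA.apply_nonneg (hYR i) ha
  simp only [sub_apply, map_sub] at this
  linarith

theorem IsMonotone.apply_le_of_tendsto (hA : IsMonotone A) (hYR : ∀ i, Y i ∈ A (R i))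
    (hR : ∀ f : StrongDual ℝ X, Tendsto (fun i => f (R i)) l (𝓝 (f z)))
    (hY : ∀ v, Tendsto (fun i => Y i v) l (𝓝 (y v)))
    (hα : Tendsto (fun i => Y i (R i)) l (𝓝 α)) : y z ≤ α := by
  -- Pass to the limit first in one index, then in the other.
  have h := ge_of_tendsto' (((tendsto_const_nhds (x := α)).sub (hR y)).sub (hY z) |>.add hα)
    fun j => hA.nonneg_of_tendsto hYR hR hY hα (hYR j)
  linarith

/-- The graph of a maximal monotone operator contains the weak limits of its points along which
the limit of the pairings does not exceed the pairing of the limits. -/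
theorem IsMaximalMonotone.mem_of_tendsto (hA : IsMaximalMonotone A) (hYR : ∀ i, Y i ∈ A (R i))
    (hR : ∀ f : StrongDual ℝ X, Tendsto (fun i => f (R i)) l (𝓝 (f z)))
    (hY : ∀ v, Tendsto (fun i => Y i v) l (𝓝 (y v)))
    (hα : Tendsto (fun i => Y i (R i)) l (𝓝 α)) (hle : α ≤ y z) : y ∈ A z :=
  hA.mem fun u a ha => by
    have := hA.1.nonneg_of_tendsto hYR hR hY hα ha
    simp only [sub_apply, map_sub]
    linarith

end

section
variable {X : Type*} [NormedAddCommGroup X] [NormedSpace ℝ X]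
  {A : X → Set (StrongDual ℝ X)} {φ : ℝ≥0 → ℝ≥0} {lam : ℝ}

/-! ### Monotonicity, boundedness and demicontinuity -/

theorem IsYosidaPair.apply_sub_sub_nonneg (hφ : IsGauge φ) (hlam : 0 < lam) {x x' z z' : X}
    {w w' : StrongDual ℝ X} (h : IsYosidaPair A φ lam x z w)
    (h' : IsYosidaPair A φ lam x' z' w') : 0 ≤ (w - w') ((x - z) - (x' - z')) := by
  obtain ⟨h1, h2, h3⟩ := apply_sub_nonneg_of_mem_dualityMap hφ h.smul_mem h'.smul_mem
  have h4 : (lam • w - lam • w') ((x - z) - (x' - z')) =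
      lam * (w - w') ((x - z) - (x' - z')) := by
    simp only [sub_apply, smul_apply, smul_eq_mul, mul_sub]
  rw [h4] at h1
  exact nonneg_of_mul_nonneg_right (by linarith) hlam

theorem IsYosidaPair.apply_nonneg (hφ : IsGauge φ) (hA : IsMonotone A) (hlam : 0 < lam)
    {x x' z z' : X} {w w' : StrongDual ℝ X} (h : IsYosidaPair A φ lam x z w)
    (h' : IsYosidaPair A φ lam x' z' w') : 0 ≤ (w - w') (x - x') := by
  have h1 := h.apply_sub_sub_nonneg hφ hlam h'
  have h2 := hA.apply_nonneg h.mem h'.mem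
  simp only [sub_apply, map_sub] at *
  linarith

theorem exists_norm_resolvent_approximant_le (hφ : IsGauge φ) (hA : IsMaximalMonotone A)
    (hlam : 0 < lam) (D : ℝ) : ∃ C, ∀ (x z : X) (w : StrongDual ℝ X), ‖x‖ ≤ D →
      IsYosidaPair A φ lam x z w → ‖x - z‖₊ ≤ C ∧ ‖z‖ ≤ D + C ∧ ‖w‖ ≤ lam⁻¹ * φ C := by
  obtain ⟨C, hC⟩ := exists_norm_sub_le hφ hA D lam
  refine ⟨C, fun x z w hx h => ?_⟩
  have h1 := hC lam x z w hlam le_rfl hx h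
  refine ⟨h1, ?_, ?_⟩
  · have h2 : ‖x - z‖ ≤ C := h1
    rw [← sub_sub_cancel x z]
    exact (norm_sub_le _ _).trans (add_le_add hx h2)
  · rw [le_inv_mul_iff₀ hlam, h.mul_norm hlam]
    exact NNReal.coe_le_coe.2 (hφ.strictMono.monotone h1)

theorem boundedOnBounded_of_norm_le {X E : Type*} [NormedAddCommGroup X]
    [NormedAddCommGroup E] {f : X → E}
    (h : ∀ D, ∃ C, ∀ x, ‖x‖ ≤ D → ‖f x‖ ≤ C) : BoundedOnBounded f := by
  intro B hB
  obtain ⟨D, hD⟩ := hB.exists_norm_le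
  obtain ⟨C, hC⟩ := h D
  refine isBounded_iff_forall_norm_le.2 ⟨C, ?_⟩
  rintro _ ⟨x, hx, rfl⟩
  exact hC x (hD x hx)

/-- The map from `x` to the resolvent-approximant pair has a norm-weakly closed graph. The limit
`r` of the norms of the displacements satisfies `φ r * r ≤ ⟨lam y, x - z⟩ ≤ φ r * r`, whence
`lam y ∈ J_φ (x - z)`. -/
theorem IsYosidaPair.of_tendsto (hφ : IsGauge φ) (hA : IsMaximalMonotone A) (hlam : 0 < lam)
    {ι : Type*} {l : Filter ι} [NeBot l] {u : ι → X} {x : X} {R : ι → X} {Y : ι → StrongDual ℝ X}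
    (h : ∀ i, IsYosidaPair A φ lam (u i) (R i) (Y i)) (hu : Tendsto u l (𝓝 x)) {z : X}
    {y : StrongDual ℝ X} (hR : ∀ f : StrongDual ℝ X, Tendsto (fun i => f (R i)) l (𝓝 (f z)))
    (hY : ∀ v, Tendsto (fun i => Y i v) l (𝓝 (y v))) {C : ℝ} (hC : ∀ᶠ i in l, ‖Y i‖ ≤ C)
    {r : ℝ≥0} (hr : Tendsto (fun i => ‖u i - R i‖₊) l (𝓝 r)) :
    IsYosidaPair A φ lam x z y := by
  have hrR : Tendsto (fun i => ‖u i - R i‖) l (𝓝 (r : ℝ)) :=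
    (NNReal.continuous_coe.tendsto r).comp hr
  have hφr : Tendsto (fun i => (φ ‖u i - R i‖₊ : ℝ)) l (𝓝 (φ r)) :=
    ((NNReal.continuous_coe.comp hφ.continuous).tendsto r).comp hr
  have hYn : Tendsto (fun i => ‖Y i‖) l (𝓝 (lam⁻¹ * φ r)) := by
    refine (hφr.const_mul lam⁻¹).congr fun i => ?_
    rw [← (h i).mul_norm hlam, inv_mul_cancel_left₀ hlam.ne']
  have hYu : Tendsto (fun i => Y i (u i)) l (𝓝 (y x)) := tendsto_apply_of_tendsto hC hY hu
  have hYR : Tendsto (fun i => Y i (R i)) l (𝓝 (y x - lam⁻¹ * φ r * r)) := by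
    refine (hYu.sub (hYn.mul hrR)).congr fun i => ?_
    rw [← (h i).apply_sub hlam, map_sub, sub_sub_cancel]
  have hmem : ∀ i, Y i ∈ A (R i) := fun i => (h i).mem
  have h1 := hA.1.apply_le_of_tendsto hmem hR hY hYR
  have hy : ‖y‖ ≤ lam⁻¹ * φ r :=
    norm_le_of_tendsto_apply (Eventually.of_forall fun i => le_rfl) hYn hY
  have hxz : ‖x - z‖ ≤ r := by
    refine norm_le_of_tendsto_apply' (Eventually.of_forall fun i => le_rfl) hrR fun f => ?_
    simp only [map_sub]
    exact ((f.continuous.tendsto x).comp hu).sub (hR f)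
  have h2 : y (x - z) ≤ ‖y‖ * ‖x - z‖ := (le_abs_self _).trans (y.le_opNorm _)
  have h3 : ‖y‖ * ‖x - z‖ ≤ lam⁻¹ * φ r * r := by gcongr
  have h4 : lam⁻¹ * φ r * r ≤ y (x - z) := by rw [map_sub]; linarith
  refine ⟨hA.mem_of_tendsto hmem hR hY hYR ?_, ?_⟩
  · rw [map_sub] at h2
    linarith
  have hnorm : ‖x - z‖₊ = r ∧ lam * ‖y‖ = φ r := by
    rcases eq_or_ne r 0 with rfl | hr0
    · rw [hφ.map_zero] at hy ⊢
      have hx0 : ‖x - z‖ = 0 := le_antisymm (by simpa using hxz) (norm_nonneg _)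
      have hy0 : ‖y‖ = 0 := le_antisymm (by simpa using hy) (norm_nonneg _)
      exact ⟨NNReal.coe_injective (by simpa using hx0), by simp [hy0]⟩
    · have hrpos : 0 < (r : ℝ) := NNReal.coe_pos.2 (pos_iff_ne_zero.2 hr0)
      have hφpos : 0 < (φ r : ℝ) := by
        have := hφ.strictMono (pos_iff_ne_zero.2 hr0)
        rw [hφ.map_zero] at this
        exact NNReal.coe_pos.2 this
      have hc : 0 < lam⁻¹ * (φ r : ℝ) := by positivity
      have e1 : (r : ℝ) ≤ ‖x - z‖ := by
        refine le_of_mul_le_mul_left ((h4.trans h2).trans ?_) hc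
        gcongr
      have e2 : lam⁻¹ * φ r ≤ ‖y‖ := by
        refine le_of_mul_le_mul_right ((h4.trans h2).trans ?_) hrpos
        gcongr
      refine ⟨NNReal.coe_injective (hxz.antisymm e1), ?_⟩
      rw [hy.antisymm e2, mul_inv_cancel_left₀ hlam.ne']
  refine ⟨?_, by rw [norm_smul, Real.norm_of_nonneg hlam.le, hnorm.1, hnorm.2]⟩
  have hr' : ‖x - z‖ = r := congrArg NNReal.toReal hnorm.1
  rw [hnorm.1, hr', ← hnorm.2, smul_apply, smul_eq_mul, mul_assoc]
  congr 1
  refine le_antisymm (h2.trans_eq (by rw [hr'])) (le_trans ?_ h4)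
  rw [← hnorm.2, inv_mul_cancel_left₀ hlam.ne']

variable [StrictConvexSpace ℝ X] [StrictConvexSpace ℝ (StrongDual ℝ X)]

theorem tendsto_resolvent_approximant (hX : IsReflexive X) (hφ : IsGauge φ)
    (hA : IsMaximalMonotone A) (hlam : 0 < lam) {R : X → X} {Y : X → StrongDual ℝ X}
    (h : ∀ x, IsYosidaPair A φ lam x (R x) (Y x)) {x : X} {U : Ultrafilter X} (hU : ↑U ≤ 𝓝 x) :
    (∀ f : StrongDual ℝ X, Tendsto (fun u => f (R u)) U (𝓝 (f (R x)))) ∧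
      ∀ v, Tendsto (fun u => Y u v) U (𝓝 (Y x v)) := by
  obtain ⟨C, hC⟩ := exists_norm_resolvent_approximant_le hφ hA hlam (‖x‖ + 1)
  have hev : ∀ᶠ u in (U : Filter X), ‖u‖ ≤ ‖x‖ + 1 :=
    hU ((continuous_norm.tendsto x).eventually (ge_mem_nhds (lt_add_one ‖x‖)))
  replace hC := hev.mono fun u hu => hC u (R u) (Y u) hu (h u)
  obtain ⟨z, hz⟩ := hX.exists_tendsto_apply_of_norm_le (hC.mono fun u hu => hu.2.1)
  obtain ⟨y, hy⟩ := exists_tendsto_apply_of_norm_le (hC.mono fun u hu => hu.2.2)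
  obtain ⟨r, -, hr⟩ := (isCompact_Icc (a := 0) (b := C)).exists_tendsto_ultrafilter
    (hC.mono fun u hu => ⟨zero_le, hu.1⟩)
  have hlim := IsYosidaPair.of_tendsto hφ hA hlam h (tendsto_id'.2 hU) hz hy
    (hC.mono fun u hu => hu.2.2) hr
  obtain rfl := hlim.resolvent_unique hφ hA.1 hlam (h x)
  obtain rfl := hlim.approximant_unique hφ hlam (h x)
  exact ⟨hz, hy⟩

theorem demicontinuous_gaugeResolvent (hX : IsReflexive X) (hφ : IsGauge φ)
    (hA : IsMaximalMonotone A) (hlam : 0 < lam) : Demicontinuous (gaugeResolvent A φ lam) := by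
  refine continuous_iff_continuousAt.2 fun x => weakTendsto_iff.2 fun f => ?_
  refine (tendsto_iff_ultrafilter _ _ _).2 fun U hU => ?_
  exact (tendsto_resolvent_approximant hX hφ hA hlam
    (isYosidaPair_yosida hX hφ hA hlam) hU).1 f

theorem demicontinuous_yosida (hX : IsReflexive X) (hφ : IsGauge φ)
    (hA : IsMaximalMonotone A) (hlam : 0 < lam) : Demicontinuous (yosida A φ lam) := by
  refine continuous_iff_continuousAt.2 fun x => hX.weakTendsto_dual_iff.2 fun v => ?_
  refine (tendsto_iff_ultrafilter _ _ _).2 fun U hU => ?_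
  exact (tendsto_resolvent_approximant hX hφ hA hlam
    (isYosidaPair_yosida hX hφ hA hlam) hU).2 v

end

/-! ### Convergence as the parameter tends to zero -/

section
variable {X : Type*} [NormedAddCommGroup X] [NormedSpace ℝ X]
  {A : X → Set (StrongDual ℝ X)} {φ : ℝ≥0 → ℝ≥0}

theorem tendsto_resolvent (hφ : IsGauge φ) (hA : IsMaximalMonotone A) {x : X}
    (hx : x ∈ closure (convexHull ℝ (dom A))) {R : ℝ → X} {Y : ℝ → StrongDual ℝ X}
    (h : ∀ lam, 0 < lam → IsYosidaPair A φ lam x (R lam) (Y lam)) :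
    Tendsto R (𝓝[>] 0) (𝓝 x) := by
  refine (tendsto_iff_ultrafilter _ _ _).2 fun U hU => ?_
  obtain ⟨C, hC⟩ := exists_norm_sub_le hφ hA ‖x‖ 1
  have hpos : ∀ᶠ lam in (U : Filter ℝ), lam ∈ Set.Ioc (0 : ℝ) 1 := hU (Ioc_mem_nhdsGT one_pos)
  have hlim : Tendsto (fun lam : ℝ => lam) U (𝓝 0) := hU.trans nhdsWithin_le_nhds
  have hC' : ∀ᶠ lam in (U : Filter ℝ), ‖x - R lam‖₊ ≤ C :=
    hpos.mono fun lam hl => hC lam x _ _ hl.1 hl.2 le_rfl (h lam hl.1)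
  obtain ⟨r, -, hr⟩ := (isCompact_Icc (a := 0) (b := C)).exists_tendsto_ultrafilter
    (hC'.mono fun u hu => ⟨zero_le, hu⟩)
  obtain ⟨j, hj⟩ := exists_tendsto_apply_of_norm_le (U := U) (u := fun lam => lam • Y lam)
    (C := φ C) (by
      filter_upwards [hpos, hC'] with lam hl hc
      rw [(h lam hl.1).smul_mem.2]
      exact NNReal.coe_le_coe.2 (hφ.strictMono.monotone hc))
  have hrR : Tendsto (fun lam => ‖x - R lam‖) U (𝓝 (r : ℝ)) :=
    (NNReal.continuous_coe.tendsto r).comp hr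
  have hφr : Tendsto (fun lam => (φ ‖x - R lam‖₊ : ℝ)) U (𝓝 (φ r)) :=
    ((NNReal.continuous_coe.comp hφ.continuous).tendsto r).comp hr
  -- The limit of the defining inequality is affine in `u`, hence extends from the domain of `A`
  -- to its closed convex hull.
  have hdom : ∀ u ∈ dom A, (φ r : ℝ) * r ≤ j (x - u) := by
    rintro u ⟨a, ha⟩
    have h1 : Tendsto (fun lam => lam * (‖a‖ * (‖x - R lam‖ + ‖x - u‖))) U (𝓝 0) := by
      simpa using hlim.mul ((hrR.add_const ‖x - u‖).const_mul ‖a‖)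
    have h2 := (hj (x - u)).add h1
    rw [add_zero] at h2
    refine le_of_tendsto_of_tendsto (hφr.mul hrR) h2 (hpos.mono fun lam hl => ?_)
    have h3 := mul_le_mul_of_nonneg_left ((h lam hl.1).norm_mul_le hl.1 hA.1 ha) hl.1.le
    have h4 := (h lam hl.1).mul_norm hl.1
    simp only [smul_apply, smul_eq_mul]
    rw [← h4]
    linarith
  have hsub : closure (convexHull ℝ (dom A)) ⊆ {u | (φ r : ℝ) * r ≤ j (x - u)} := by
    refine closure_minimal (convexHull_min hdom ?_)
      (isClosed_le continuous_const (j.continuous.comp (continuous_const.sub continuous_id)))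
    have : {u | (φ r : ℝ) * r ≤ j (x - u)} = {u | j u ≤ j x - φ r * r} := by
      ext u
      simp only [Set.mem_ofPred_eq, map_sub]
      constructor <;> intro <;> linarith
    rw [this]
    exact convex_halfSpace_le j.toLinearMap.isLinear _
  have hle : (φ r : ℝ) * r ≤ 0 := by simpa using hsub hx
  have hr0 : r = 0 := by
    by_contra hne
    have hrpos := pos_iff_ne_zero.2 hne
    have hφpos := hφ.strictMono hrpos
    rw [hφ.map_zero] at hφpos
    have : (0 : ℝ) < φ r * r := mul_pos (NNReal.coe_pos.2 hφpos) (NNReal.coe_pos.2 hrpos)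
    linarith
  rw [hr0, NNReal.coe_zero] at hrR
  exact tendsto_iff_norm_sub_tendsto_zero.2 (hrR.congr fun lam => norm_sub_rev _ _)

/-- If the approximants stay bounded while the parameters tend to zero, the displacements do too. -/
theorem tendsto_norm_sub_resolvent (hφ : IsGauge φ) {lam : ℕ → ℝ} (hlam : ∀ n, 0 < lam n)
    (hlim : Tendsto lam atTop (𝓝 0)) {u R : ℕ → X} {Y : ℕ → StrongDual ℝ X} {C : ℝ}
    (hC : ∀ n, ‖Y n‖ ≤ C) (h : ∀ n, IsYosidaPair A φ (lam n) (u n) (R n) (Y n)) :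
    Tendsto (fun n => ‖u n - R n‖) atTop (𝓝 0) := by
  have h1 : Tendsto (fun n => (φ ‖u n - R n‖₊ : ℝ)) atTop (𝓝 0) := by
    have h2 : Tendsto (fun n => lam n * C) atTop (𝓝 0) := by simpa using hlim.mul_const C
    refine squeeze_zero (fun n => NNReal.coe_nonneg _) (fun n => ?_) h2
    rw [← (h n).mul_norm (hlam n)]
    exact mul_le_mul_of_nonneg_left (hC n) (hlam n).le
  have h3 : Tendsto (fun n => φ ‖u n - R n‖₊) atTop (𝓝 0) := by
    rw [← NNReal.tendsto_coe]; simpa using h1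
  have h4 := (hφ.orderIso.symm.continuous.tendsto 0).comp h3
  have h5 : hφ.orderIso.symm 0 = 0 := by simpa using hφ.orderIso.symm.map_bot
  rw [h5, ← NNReal.tendsto_coe] at h4
  refine h4.congr fun n => ?_
  change ((hφ.orderIso.symm (hφ.orderIso ‖u n - R n‖₊) : ℝ≥0) : ℝ) = _
  rw [OrderIso.symm_apply_apply, coe_nnnorm]

/-- Closedness of the graph under weak convergence of the approximants. -/
theorem mem_and_tendsto_of_limsup_le [CompleteSpace X] (hX : IsReflexive X) (hφ : IsGauge φ)
    (hA : IsMaximalMonotone A) {lam : ℕ → ℝ} (hlam : ∀ n, 0 < lam n)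
    (hlim : Tendsto lam atTop (𝓝 0)) {u R : ℕ → X} {Y : ℕ → StrongDual ℝ X}
    (h : ∀ n, IsYosidaPair A φ (lam n) (u n) (R n) (Y n)) {x : X} {y : StrongDual ℝ X}
    (hu : WeakTendsto u atTop x) (hY : WeakTendsto Y atTop y)
    (hsup : limsup (fun p : ℕ × ℕ => (((Y p.1 - Y p.2) (u p.1 - u p.2) : ℝ) : EReal))
      (atTop ×ˢ atTop) ≤ 0) :
    y ∈ A x ∧ Tendsto (fun p : ℕ × ℕ => (Y p.1 - Y p.2) (u p.1 - u p.2))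
      (atTop ×ˢ atTop) (𝓝 0) := by
  obtain ⟨D, hD⟩ := hu.exists_norm_le
  rw [weakTendsto_iff] at hu
  rw [hX.weakTendsto_dual_iff] at hY
  obtain ⟨C, hC⟩ := exists_norm_le_of_tendsto_apply hY
  have hC0 : 0 ≤ C := (norm_nonneg _).trans (hC 0)
  have hr := tendsto_norm_sub_resolvent hφ hlam hlim hC h
  have hdisp : Tendsto (fun n => Y n (u n - R n)) atTop (𝓝 0) := by
    refine squeeze_zero_norm (fun n => (Y n).le_of_opNorm_le (hC n) _) ?_
    simpa using hr.const_mul C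
  have hdbl : Tendsto (fun p : ℕ × ℕ => (Y p.1 - Y p.2) (u p.1 - u p.2))
      (atTop ×ˢ atTop) (𝓝 0) := by
    refine tendsto_order.2 ⟨fun b hb => ?_, fun b hb => ?_⟩
    · have h1 : Tendsto (fun p : ℕ × ℕ => -(2 * C * (‖u p.1 - R p.1‖ + ‖u p.2 - R p.2‖)))
          (atTop ×ˢ atTop) (𝓝 0) := by
        simpa using (((hr.comp tendsto_fst).add (hr.comp tendsto_snd)).const_mul (2 * C)).neg
      filter_upwards [h1.eventually (lt_mem_nhds hb)] with p hp
      refine hp.trans_le ?_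
      have h2 := hA.1.apply_nonneg (h p.1).mem (h p.2).mem
      have h3 : ‖Y p.1 - Y p.2‖ ≤ 2 * C :=
        (norm_sub_le _ _).trans (by linarith [hC p.1, hC p.2])
      have h4 := (neg_le_abs _).trans
        ((Y p.1 - Y p.2).le_of_opNorm_le h3 ((u p.1 - R p.1) - (u p.2 - R p.2)))
      have h5 : 2 * C * ‖(u p.1 - R p.1) - (u p.2 - R p.2)‖ ≤
          2 * C * (‖u p.1 - R p.1‖ + ‖u p.2 - R p.2‖) := by
        gcongr
        exact norm_sub_le _ _
      have h6 : u p.1 - u p.2 =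
          (R p.1 - R p.2) + ((u p.1 - R p.1) - (u p.2 - R p.2)) := by abel
      rw [h6, map_add]
      linarith
    · have h1 := eventually_lt_of_limsup_lt (hsup.trans_lt (EReal.coe_pos.2 hb))
      exact h1.mono fun p hp => EReal.coe_lt_coe_iff.1 hp
  refine ⟨?_, hdbl⟩
  let U : Ultrafilter ℕ := Ultrafilter.of atTop
  have hU : (U : Filter ℕ) ≤ atTop := Ultrafilter.of_le atTop
  obtain ⟨α, hα⟩ := exists_tendsto_of_abs_le (U := U) (f := fun n => Y n (u n)) (C := C * D)
    (Eventually.of_forall fun n => ((Y n).le_of_opNorm_le (hC n) _).trans (by gcongr; exact hD n))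
  have hα' : Tendsto (fun n => Y n (R n)) U (𝓝 α) := by
    have := hα.sub (hdisp.mono_left hU)
    simpa using this
  have hR : ∀ f : StrongDual ℝ X, Tendsto (fun n => f (R n)) atTop (𝓝 (f x)) := by
    intro f
    have h1 : Tendsto (fun n => f (u n - R n)) atTop (𝓝 0) := by
      refine squeeze_zero_norm (fun n => f.le_opNorm _) ?_
      simpa using hr.const_mul ‖f‖
    have := (hu f).sub h1
    simpa using this
  refine hA.mem_of_tendsto (l := (U : Filter ℕ)) (fun n => (h n).mem)
    (fun f => (hR f).mono_left hU) (fun v => (hY v).mono_left hU) hα' ?_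
  -- Along the ultrafilter the double limit can be taken one index at a time; it is
  -- `2 α - 2 ⟨y, x⟩`.
  refine le_of_forall_pos_le_add fun ε hε => ?_
  have hev := hdbl.eventually (gt_mem_nhds hε)
  have hev' : ∀ᶠ m in (U : Filter ℕ), ∀ᶠ n in (U : Filter ℕ),
      (Y m - Y n) (u m - u n) < ε :=
    (hev.filter_mono (prod_mono hU hU)).curry
  have h1 : ∀ᶠ m in (U : Filter ℕ), Y m (u m) - Y m x - y (u m) + α ≤ ε := by
    filter_upwards [hev'] with m hm
    refine le_of_tendsto (((tendsto_const_nhds.sub ((hu (Y m)).mono_left hU)).sub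
      ((hY (u m)).mono_left hU)).add hα) (hm.mono fun n hn => ?_)
    simp only [sub_apply, map_sub] at hn
    linarith
  have h2 := le_of_tendsto (((hα.sub ((hY x).mono_left hU)).sub
    ((hu y).mono_left hU)).add_const α) h1
  linarith

/-- Elements of minimal norm are unique because the values are convex. -/
theorem IsMinimalSection.unique [StrictConvexSpace ℝ (StrongDual ℝ X)]
    (hA : IsMaximalMonotone A) {x : X} {y z : StrongDual ℝ X} (hy : IsMinimalSection A x y)
    (hz : IsMinimalSection A x z) : z = y := by
  refine eq_of_norm_eq_of_norm_add_eq (hz.2.trans hy.2.symm) ((norm_add_le _ _).antisymm ?_)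
  have hmid : (1 / 2 : ℝ) • z + (1 / 2 : ℝ) • y ∈ A x :=
    hA.convex x hz.1 hy.1 (by norm_num) (by norm_num) (by norm_num)
  have h1 : minNorm A x ≤ ‖(1 / 2 : ℝ) • z + (1 / 2 : ℝ) • y‖ :=
    csInf_le ⟨0, by rintro _ ⟨a, -, rfl⟩; exact norm_nonneg a⟩ ⟨_, hmid, rfl⟩
  rw [← smul_add, norm_smul] at h1
  norm_num at h1
  rw [hz.2, hy.2]
  linarith

/-- At a point of the domain the weak cluster points of the approximants are elements of minimal
norm. -/
theorem isMinimalSection_of_tendsto (hφ : IsGauge φ) (hA : IsMaximalMonotone A) {ι : Type*}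
    {l : Filter ι} [NeBot l] {lam : ι → ℝ} (hlam : ∀ i, 0 < lam i) {x : X} (hx : x ∈ dom A)
    {R : ι → X} {Y : ι → StrongDual ℝ X} (h : ∀ i, IsYosidaPair A φ (lam i) x (R i) (Y i))
    (hR : Tendsto R l (𝓝 x)) {y : StrongDual ℝ X}
    (hY : ∀ v, Tendsto (fun i => Y i v) l (𝓝 (y v))) : IsMinimalSection A x y := by
  have hle : ∀ᶠ i in l, ‖Y i‖ ≤ minNorm A x :=
    Eventually.of_forall fun i => (h i).norm_le_minNorm hφ (hlam i) hA.1 hx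
  have hmem : y ∈ A x := hA.mem_of_tendsto (fun i => (h i).mem)
    (fun f => (f.continuous.tendsto x).comp hR) hY (tendsto_apply_of_tendsto hle hY hR) le_rfl
  exact ⟨hmem, (norm_le_of_tendsto_apply hle tendsto_const_nhds hY).antisymm
    (csInf_le ⟨0, by rintro _ ⟨a, -, rfl⟩; exact norm_nonneg a⟩ ⟨_, hmem, rfl⟩)⟩

/-- Off the closure of the domain the displacements stay away from zero. -/
theorem tendsto_norm_approximant_atTop (hφ : IsGauge φ) {lam : ℕ → ℝ} (hlam : ∀ n, 0 < lam n)
    (hlim : Tendsto lam atTop (𝓝 0)) {x : X} (hx : x ∉ closure (dom A)) {R : ℕ → X}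
    {Y : ℕ → StrongDual ℝ X} (h : ∀ n, IsYosidaPair A φ (lam n) x (R n) (Y n)) :
    Tendsto (fun n => ‖Y n‖) atTop atTop := by
  rw [Metric.mem_closure_iff] at hx
  push Not at hx
  obtain ⟨ε, hε, hx⟩ := hx
  lift ε to ℝ≥0 using hε.le
  have hφpos := hφ.strictMono (NNReal.coe_pos.1 hε)
  rw [hφ.map_zero] at hφpos
  have h1 : Tendsto (fun n => (lam n)⁻¹ * (φ ε : ℝ)) atTop atTop :=
    ((tendsto_inv_nhdsGT_zero.comp (tendsto_nhdsWithin_iff.2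
      ⟨hlim, Eventually.of_forall hlam⟩))).atTop_mul_const (NNReal.coe_pos.2 hφpos)
  refine tendsto_atTop_mono (fun n => ?_) h1
  rw [inv_mul_le_iff₀ (hlam n), (h n).mul_norm (hlam n)]
  refine NNReal.coe_le_coe.2 (hφ.strictMono.monotone (NNReal.coe_le_coe.1 ?_))
  rw [coe_nnnorm, ← dist_eq_norm]
  exact hx (R n) ⟨Y n, (h n).mem⟩

end

section
variable {X : Type*} [NormedAddCommGroup X] [NormedSpace ℝ X]
  [StrictConvexSpace ℝ X] [StrictConvexSpace ℝ (StrongDual ℝ X)]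

/-- Weak convergence of the approximants to the element of minimal norm, and strong convergence
if the dual is uniformly convex. -/
theorem exists_isMinimalSection_and_tendsto (hX : IsReflexive X) {φ : ℝ≥0 → ℝ≥0}
    (hφ : IsGauge φ) {A : X → Set (StrongDual ℝ X)} (hA : IsMaximalMonotone A) {x : X}
    (hx : x ∈ dom A) :
    ∃ y : StrongDual ℝ X, IsMinimalSection A x y ∧ (∀ z, IsMinimalSection A x z → z = y) ∧
      ∀ lam : ℕ → ℝ, (∀ n, 0 < lam n) → Tendsto lam atTop (𝓝 0) →
        WeakTendsto (fun n => yosida A φ (lam n) x) atTop y ∧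
        (UniformConvexSpace (StrongDual ℝ X) →
          Tendsto (fun n => yosida A φ (lam n) x) atTop (𝓝 y)) := by
  have hpair : ∀ lam, 0 < lam →
      IsYosidaPair A φ lam x (gaugeResolvent A φ lam x) (yosida A φ lam x) :=
    fun lam hlam => isYosidaPair_yosida hX hφ hA hlam x
  have key : ∀ (lam : ℕ → ℝ), (∀ n, 0 < lam n) → Tendsto lam atTop (𝓝 0) →
      ∀ U : Ultrafilter ℕ, ↑U ≤ (atTop : Filter ℕ) → ∃ y, IsMinimalSection A x y ∧
        ∀ v, Tendsto (fun n => yosida A φ (lam n) x v) U (𝓝 (y v)) := by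
    intro lam hlam hlim U hU
    obtain ⟨y, hy⟩ := exists_tendsto_apply_of_norm_le (U := U)
      (u := fun n => yosida A φ (lam n) x) (C := minNorm A x)
      (Eventually.of_forall fun n => (hpair _ (hlam n)).norm_le_minNorm hφ (hlam n) hA.1 hx)
    have hR : Tendsto (fun n => gaugeResolvent A φ (lam n) x) U (𝓝 x) :=
      (tendsto_resolvent hφ hA (subset_closure (subset_convexHull ℝ _ hx)) hpair).comp
        (tendsto_nhdsWithin_iff.2 ⟨hlim.mono_left hU, Eventually.of_forall hlam⟩)
    exact ⟨y, isMinimalSection_of_tendsto hφ hA hlam hx (fun n => hpair _ (hlam n)) hR hy, hy⟩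
  obtain ⟨y, hy, -⟩ := key (fun n => 1 / ((n : ℝ) + 1)) (fun n => Nat.one_div_pos_of_nat)
    tendsto_one_div_add_atTop_nhds_zero_nat (Ultrafilter.of atTop) (Ultrafilter.of_le atTop)
  refine ⟨y, hy, fun z hz => hy.unique hA hz, fun lam hlam hlim => ?_⟩
  have hweak : ∀ v, Tendsto (fun n => yosida A φ (lam n) x v) atTop (𝓝 (y v)) := by
    refine fun v => (tendsto_iff_ultrafilter _ _ _).2 fun U hU => ?_
    obtain ⟨z, hz, hzlim⟩ := key lam hlam hlim U hU
    obtain rfl := hy.unique hA hz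
    exact hzlim v
  refine ⟨hX.weakTendsto_dual_iff.2 hweak, fun _ => ?_⟩
  refine tendsto_of_norm_le_of_uniformConvex (Eventually.of_forall fun n => ?_) hweak
  rw [hy.2]
  exact (hpair _ (hlam n)).norm_le_minNorm hφ (hlam n) hA.1 hx

end

end GaugeYosida

theorem proposition2p1 {X : Type*} [NormedAddCommGroup X] [NormedSpace ℝ X] [CompleteSpace X]
    [StrictConvexSpace ℝ X] [StrictConvexSpace ℝ (StrongDual ℝ X)]
    (hX : GaugeYosida.IsReflexive X)
    (φ : ℝ≥0 → ℝ≥0) (hφ : GaugeYosida.IsGauge φ)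
    (A : X → Set (StrongDual ℝ X)) (hA : GaugeYosida.IsMaximalMonotone A) :
    -- the inclusion has exactly one solution, so that the resolvent is well defined
    (∀ lam : ℝ, 0 < lam → ∀ x : X,
      GaugeYosida.solutionSet A φ lam x = {GaugeYosida.gaugeResolvent A φ lam x}) ∧
    -- the approximant
    (∀ lam : ℝ, 0 < lam →
      (∀ x : X, GaugeYosida.yosidaSet A φ lam x = {GaugeYosida.yosida A φ lam x}) ∧
      GaugeYosida.IsMonotone (fun x => {GaugeYosida.yosida A φ lam x}) ∧
      GaugeYosida.BoundedOnBounded (GaugeYosida.yosida A φ lam) ∧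
      GaugeYosida.Demicontinuous (GaugeYosida.yosida A φ lam)) ∧
    -- norm bound on the domain
    (∀ x ∈ GaugeYosida.dom A, ∀ lam : ℝ, 0 < lam →
      ‖GaugeYosida.yosida A φ lam x‖ ≤ GaugeYosida.minNorm A x) ∧
    -- the resolvent
    ((∀ lam : ℝ, 0 < lam →
        GaugeYosida.BoundedOnBounded (GaugeYosida.gaugeResolvent A φ lam) ∧
        (∀ x : X, GaugeYosida.gaugeResolvent A φ lam x ∈ GaugeYosida.dom A) ∧
        GaugeYosida.Demicontinuous (GaugeYosida.gaugeResolvent A φ lam)) ∧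
      ∀ x ∈ closure (convexHull ℝ (GaugeYosida.dom A)),
        Tendsto (fun lam : ℝ => GaugeYosida.gaugeResolvent A φ lam x) (𝓝[>] 0) (𝓝 x)) ∧
    -- graph closure
    (∀ (lam : ℕ → ℝ) (u : ℕ → X) (x : X) (y : StrongDual ℝ X),
      (∀ n, 0 < lam n) → Tendsto lam atTop (𝓝 0) →
      GaugeYosida.WeakTendsto u atTop x →
      GaugeYosida.WeakTendsto (fun n => GaugeYosida.yosida A φ (lam n) (u n)) atTop y →
      limsup (fun p : ℕ × ℕ =>
        (((GaugeYosida.yosida A φ (lam p.1) (u p.1) - GaugeYosida.yosida A φ (lam p.2) (u p.2))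
          (u p.1 - u p.2) : ℝ) : EReal)) (atTop ×ˢ atTop) ≤ 0 →
      (x, y) ∈ GaugeYosida.graph A ∧
      Tendsto (fun p : ℕ × ℕ =>
        (GaugeYosida.yosida A φ (lam p.1) (u p.1) - GaugeYosida.yosida A φ (lam p.2) (u p.2))
          (u p.1 - u p.2)) (atTop ×ˢ atTop) (𝓝 0)) ∧
    -- convergence to the minimal section
    (∀ x ∈ GaugeYosida.dom A, ∃ y : StrongDual ℝ X,
      GaugeYosida.IsMinimalSection A x y ∧
      (∀ z, GaugeYosida.IsMinimalSection A x z → z = y) ∧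
      ∀ lam : ℕ → ℝ, (∀ n, 0 < lam n) → Tendsto lam atTop (𝓝 0) →
        GaugeYosida.WeakTendsto (fun n => GaugeYosida.yosida A φ (lam n) x) atTop y ∧
        (UniformConvexSpace (StrongDual ℝ X) →
          Tendsto (fun n => GaugeYosida.yosida A φ (lam n) x) atTop (𝓝 y))) ∧
    -- blow-up off the closure of the domain
    (∀ lam : ℕ → ℝ, (∀ n, 0 < lam n) → Tendsto lam atTop (𝓝 0) →
      ∀ x : X, x ∉ closure (GaugeYosida.dom A) →
        Tendsto (fun n => ‖GaugeYosida.yosida A φ (lam n) x‖) atTop atTop) := by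
  have hpair : ∀ lam, 0 < lam → ∀ x, GaugeYosida.IsYosidaPair A φ lam x
      (GaugeYosida.gaugeResolvent A φ lam x) (GaugeYosida.yosida A φ lam x) :=
    fun lam hlam x => GaugeYosida.isYosidaPair_yosida hX hφ hA hlam x
  refine ⟨fun lam hlam x => GaugeYosida.solutionSet_eq_singleton hX hφ hA hlam x,
    fun lam hlam => ⟨fun x => GaugeYosida.yosidaSet_eq_singleton hX hφ hA hlam x, ?_, ?_,
      GaugeYosida.demicontinuous_yosida hX hφ hA hlam⟩,
    fun x hx lam hlam => (hpair lam hlam x).norm_le_minNorm hφ hlam hA.1 hx,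
    ⟨fun lam hlam => ⟨?_, fun x => ⟨_, (hpair lam hlam x).mem⟩,
      GaugeYosida.demicontinuous_gaugeResolvent hX hφ hA hlam⟩,
      fun x hx => GaugeYosida.tendsto_resolvent hφ hA hx fun lam hlam => hpair lam hlam x⟩,
    fun lam u x y hlam hlim hu hY hsup =>
      GaugeYosida.mem_and_tendsto_of_limsup_le hX hφ hA hlam hlim
        (fun n => hpair _ (hlam n) (u n)) hu hY hsup,
    fun x hx => GaugeYosida.exists_isMinimalSection_and_tendsto hX hφ hA hx,
    fun lam hlam hlim x hx => GaugeYosida.tendsto_norm_approximant_atTop hφ hlam hlim hx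
      fun n => hpair _ (hlam n) x⟩
  · rintro ⟨x, w⟩ hw ⟨x', w'⟩ hw'
    obtain rfl : w = GaugeYosida.yosida A φ lam x := hw
    obtain rfl : w' = GaugeYosida.yosida A φ lam x' := hw'
    exact (hpair lam hlam x).apply_nonneg hφ hA.1 hlam (hpair lam hlam x')
  · refine GaugeYosida.boundedOnBounded_of_norm_le fun D => ?_
    obtain ⟨C, hC⟩ := GaugeYosida.exists_norm_resolvent_approximant_le hφ hA hlam D
    exact ⟨_, fun x hx => (hC x _ _ hx (hpair lam hlam x)).2.2⟩
  · refine GaugeYosida.boundedOnBounded_of_norm_le fun D => ?_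
    obtain ⟨C, hC⟩ := GaugeYosida.exists_norm_resolvent_approximant_le hφ hA hlam D
    exact ⟨_, fun x hx => (hC x _ _ hx (hpair lam hlam x)).2.1⟩
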